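/- Let $(M^{2m+1},H,J,\theta)$ be a (non-empty, strictly pseudoconvex) pseudo-Hermitian manifold: $M$ is a smooth manifold of dimension $2m+1$, $\theta$ is a smooth nowhere vanishing one-form, $H=\ker\theta$, $J$ is a complex structure on $H$ such that $T_{1,0}M=\{X-\sqrt{-1}JX: X\in H\}$ is closed under Lie brackets of sections, and the Levi form $L_\theta(X,Y)=d\theta(X,JY)$ is positive definite on $H$, where $2\,d\theta(X,Y)=X\theta(Y)-Y\theta(X)-\theta([X,Y])$. Let $\xi$ be the Reeb vector field ($\theta(\xi)=1$, $d\theta(\xi,\cdot)=0$), $\pi_H$ and $\pi_L$ the projections of $TM=H\oplus\mathbb R\xi$ onto its summands, and $g_\theta=L_\theta(\pi_H\cdot,\pi_H\cdot)+\theta\otimes\theta$ the Webster metric, with norm $|\cdot|$ and gradient $\nabla$; put $\nabla^H u=\pi_H(\nabla u)$, $\nabla^L u=\pi_L(\nabla u)$. Let $\Delta_b u=\operatorname{trace}_H(\nabla du)$, $(\nabla du)(Y,Z)=Y(Zu)-(\nabla_YZ)u$, be the sub-Laplacian, where in the latter formula $\nabla$ is the Tanaka–Webster connection. Assume that there are a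 non-negative $C^2$ function $\gamma$ on $M$, constants $A,B>0$ and a smooth function $G$ on $[0,+\infty)$ such that $\lim_{x\to\infty}\gamma(x)=+\infty$ (that is, for every $\eta>0$ there is a compact set outside which $\gamma>\eta$), such that $$|\nabla\gamma|\le A\gamma^{1/2}\quad\text{and}\quad \Delta_b\gamma\le B\gamma^{1/2}G(\gamma^{1/2})^{1/2}\quad\text{outside some compact subset of } M,$$ and such that $G(0)>0$, $G'\ge0$, $G^{-1/2}\notin L^1(+\infty)$ and $\limsup_{t\to+\infty}\frac{t\,G(t^{1/2})}{G(t)}<+\infty$. Let $\phi(t,x_1,x_2)$ be a real function of $t\in\mathbb R$ and $x_1,x_2\ge0$ that is continuous in $t$, $C^2$ in $(x_1,x_2)$ (up to the boundary of the quadrant), and satisfies $(\mathrm{Hess}_{x_1,x_2}\phi)(t,x_1,x_2)\ge0$. Let $u$ be a $C^2$ function on $M$ with $$\Delta_b u\ge\phi(u,|\nabla^Lu|,|\nabla^Hu|),$$ and set $f(t)=\phi(t,0,0)$. Let $F$ be a continuous function that is positive on some interval $[a,+\infty)$ and satisfies $$\int_b^\infty\Big\{\int_a^tF(s)\,ds\Big\}^{-1/2}dt<+\infty\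 \text{ for some } b>a,\qquad \limsup_{t\to+\infty}\frac{\int_a^tF(s)\,ds}{tF(t)}<+\infty,$$ $$\liminf_{t\to+\infty}\frac{\{\int_a^tF(s)\,ds\}^{1/2}}{F(t)}\,\frac{\partial\phi}{\partial x_i}(t,0,0)>-\infty,\qquad i=1,2,$$ where the partial derivatives at the corner $(0,0)$ are one-sided. 1. If $\liminf_{t\to+\infty}\frac{f(t)}{F(t)}>0$, then $u$ is bounded above on $M$ and $f(\sup_Mu)\le0$. 2. If $\liminf_{t\to+\infty}\frac{f(t)}{F(t)}\le0$, then either $\sup_Mu=+\infty$, or $u$ is bounded above on $M$ and $f(\sup_Mu)\le0$. -/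

import Mathlib

open Bundle FiberBundle VectorField Filter Topology
open scoped Manifold ContDiff

noncomputable section

set_option linter.unusedSectionVars false

namespace CR

variable {E : Type*} [NormedAddCommGroup E] [NormedSpace ℝ E]
  {M : Type*} [TopologicalSpace M] [ChartedSpace E M] [IsManifold 𝓘(ℝ, E) ∞ M]

/-- A (not necessarily continuous) real vector field on `M`. -/
abbrev VF (E : Type*) [NormedAddCommGroup E] [NormedSpace ℝ E]
    (M : Type*) [TopologicalSpace M] [ChartedSpace E M] : Type _ :=
  Π x : M, TangentSpace 𝓘(ℝ, E) x

/-- `X` is of class `C^∞` near `x`. -/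
def SmoothVFAt (X : VF E M) (x : M) : Prop :=
  ContMDiffAt 𝓘(ℝ, E) (𝓘(ℝ, E).prod 𝓘(ℝ, E)) ∞
    (fun y => TotalSpace.mk' E (E := fun y : M => TangentSpace 𝓘(ℝ, E) y) y (X y)) x

/-- `X` is differentiable at `x`. -/
def DiffVFAt (X : VF E M) (x : M) : Prop :=
  MDifferentiableAt 𝓘(ℝ, E) (𝓘(ℝ, E).prod 𝓘(ℝ, E))
    (fun y => TotalSpace.mk' E (E := fun y : M => TangentSpace 𝓘(ℝ, E) y) y (X y)) x

lemma SmoothVFAt.diff {X : VF E M} {x : M} (h : SmoothVFAt X x) : DiffVFAt X x :=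
  ContMDiffAt.mdifferentiableAt h (by simp)

/-- A `C^∞` real one-form, i.e. a smooth section of the cotangent bundle. -/
def SmoothForm (θ : Π x : M, TangentSpace 𝓘(ℝ, E) x →L[ℝ] ℝ) : Prop :=
  ContMDiff 𝓘(ℝ, E) (𝓘(ℝ, E).prod 𝓘(ℝ, E →L[ℝ] ℝ)) ∞
    (fun x => TotalSpace.mk' (E →L[ℝ] ℝ)
      (E := fun x : M => TangentSpace 𝓘(ℝ, E) x →L[ℝ] Bundle.Trivial M ℝ x) x (θ x))

/-- A `C^∞` tensor field of type `(1,1)`, i.e. a smooth section of `End(TM)`. -/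
def SmoothEnd (J : Π x : M, TangentSpace 𝓘(ℝ, E) x →L[ℝ] TangentSpace 𝓘(ℝ, E) x) : Prop :=
  ContMDiff 𝓘(ℝ, E) (𝓘(ℝ, E).prod 𝓘(ℝ, E →L[ℝ] E)) ∞
    (fun x => TotalSpace.mk' (E →L[ℝ] E)
      (E := fun x : M => TangentSpace 𝓘(ℝ, E) x →L[ℝ] TangentSpace 𝓘(ℝ, E) x) x (J x))

lemma SmoothForm.apply {θ : Π x : M, TangentSpace 𝓘(ℝ, E) x →L[ℝ] ℝ} (hθ : SmoothForm θ)
    {X : VF E M} {x : M} (hX : DiffVFAt X x) :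
    MDifferentiableAt 𝓘(ℝ, E) 𝓘(ℝ, ℝ) (fun y => θ y (X y)) x := by
  have h1 := (hθ x).mdifferentiableAt (by simp)
  have := MDifferentiableAt.clm_bundle_apply (F₁ := E) (F₂ := ℝ)
    (E₁ := fun y : M => TangentSpace 𝓘(ℝ, E) y) (E₂ := Bundle.Trivial M ℝ)
    (b := fun y : M => y) (ϕ := fun y => θ y) (v := X) h1 hX
  simp only [mdifferentiableAt_totalSpace] at this
  exact this.2

lemma SmoothForm.apply_smooth {θ : Π x : M, TangentSpace 𝓘(ℝ, E) x →L[ℝ] ℝ} (hθ : SmoothForm θ)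
    {X : VF E M} {x : M} (hX : SmoothVFAt X x) :
    ContMDiffAt 𝓘(ℝ, E) 𝓘(ℝ, ℝ) ∞ (fun y => θ y (X y)) x := by
  have := ContMDiffAt.clm_bundle_apply (F₁ := E) (F₂ := ℝ)
    (E₁ := fun y : M => TangentSpace 𝓘(ℝ, E) y) (E₂ := Bundle.Trivial M ℝ)
    (b := fun y : M => y) (ϕ := fun y => θ y) (v := X) (hθ x) hX
  simp only [contMDiffAt_totalSpace] at this
  exact this.2

lemma SmoothEnd.apply {J : Π x : M, TangentSpace 𝓘(ℝ, E) x →L[ℝ] TangentSpace 𝓘(ℝ, E) x}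
    (hJ : SmoothEnd J) {X : VF E M} {x : M} (hX : SmoothVFAt X x) :
    SmoothVFAt (fun y => J y (X y)) x :=
  ContMDiffAt.clm_bundle_apply (F₁ := E) (F₂ := E)
    (E₁ := fun y : M => TangentSpace 𝓘(ℝ, E) y) (E₂ := fun y : M => TangentSpace 𝓘(ℝ, E) y)
    (b := fun y : M => y) (ϕ := fun y => J y) (v := X) (hJ x) hX

/-- The expression `(X(θ(Y)) - Y(θ(X)) - θ([X, Y])) / 2` at `x`. -/
def dAux (θ : Π x : M, TangentSpace 𝓘(ℝ, E) x →L[ℝ] ℝ) (X Y : VF E M) (x : M) : ℝ :=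
  (1 / 2 : ℝ) * (mvfderiv 𝓘(ℝ, E) (fun y => θ y (Y y)) x (X x)
    - mvfderiv 𝓘(ℝ, E) (fun y => θ y (X y)) x (Y x)
    - θ x (mlieBracket 𝓘(ℝ, E) X Y x))

variable [FiniteDimensional ℝ E]

lemma dAux_tensorial₁ {θ : Π x : M, TangentSpace 𝓘(ℝ, E) x →L[ℝ] ℝ} (hθ : SmoothForm θ) (x : M)
    (Y : VF E M) :
    TensorialAt 𝓘(ℝ, E) E (fun X : VF E M => dAux θ X Y x) x where
  smul {f X} hf hX := by
    have h1 := mvfderiv_fun_mul hf (hθ.apply hX)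
    have h2 := mlieBracket_smul_left (W := Y) hf hX
    simp [dAux, h1, h2]
    ring
  add {X X'} hX hX' := by
    have h1 := mvfderiv_fun_add (hθ.apply hX) (hθ.apply hX')
    have h2 := mlieBracket_add_left (W := Y) hX hX'
    simp [dAux, h1, h2]
    ring

lemma dAux_tensorial₂ {θ : Π x : M, TangentSpace 𝓘(ℝ, E) x →L[ℝ] ℝ} (hθ : SmoothForm θ) (x : M)
    (X : VF E M) :
    TensorialAt 𝓘(ℝ, E) E (fun Y : VF E M => dAux θ X Y x) x where
  smul {f Y} hf hY := by
    have h1 := mvfderiv_fun_mul hf (hθ.apply hY)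
    have h2 := mlieBracket_smul_right (V := X) hf hY
    simp [dAux, h1, h2]
    ring
  add {Y Y'} hY hY' := by
    have h1 := mvfderiv_fun_add (hθ.apply hY) (hθ.apply hY')
    have h2 := mlieBracket_add_right (V := X) hY hY'
    simp [dAux, h1, h2]
    ring

/-- The exterior derivative `dθ` of a smooth one-form as a tensor, with the normalization
`2 dθ(X, Y) = X(θ(Y)) - Y(θ(X)) - θ([X, Y])`, under which the torsion of the Tanaka-Webster
connection is `2 dθ ⊗ ξ` on the Levi distribution. -/
def extD (θ : Π x : M, TangentSpace 𝓘(ℝ, E) x →L[ℝ] ℝ) (hθ : SmoothForm θ) (x : M) :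
    TangentSpace 𝓘(ℝ, E) x →L[ℝ] TangentSpace 𝓘(ℝ, E) x →L[ℝ] ℝ :=
  TensorialAt.mkHom₂ (I := 𝓘(ℝ, E)) (F := E) (F' := E) (fun X Y : VF E M => dAux θ X Y x) x
    (fun Y _ => dAux_tensorial₁ hθ x Y) (fun X _ => dAux_tensorial₂ hθ x X)

lemma extD_apply {θ : Π x : M, TangentSpace 𝓘(ℝ, E) x →L[ℝ] ℝ} (hθ : SmoothForm θ) {x : M}
    {X Y : VF E M} (hX : DiffVFAt X x) (hY : DiffVFAt Y x) :
    extD θ hθ x (X x) (Y x) = dAux θ X Y x :=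
  TensorialAt.mkHom₂_apply _ _ hX hY

lemma dAux_swap (θ : Π x : M, TangentSpace 𝓘(ℝ, E) x →L[ℝ] ℝ) (X Y : VF E M) (x : M) :
    dAux θ X Y x = - dAux θ Y X x := by
  have h := mlieBracket_swap_apply (I := 𝓘(ℝ, E)) (V := X) (W := Y) (x := x)
  simp only [dAux, h, map_neg]
  ring

lemma extD_swap {θ : Π x : M, TangentSpace 𝓘(ℝ, E) x →L[ℝ] ℝ} (hθ : SmoothForm θ) (x : M)
    (v w : TangentSpace 𝓘(ℝ, E) x) : extD θ hθ x v w = - extD θ hθ x w v :=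
  dAux_swap θ (extend E v) (extend E w) x

lemma extD_self {θ : Π x : M, TangentSpace 𝓘(ℝ, E) x →L[ℝ] ℝ} (hθ : SmoothForm θ) (x : M)
    (v : TangentSpace 𝓘(ℝ, E) x) : extD θ hθ x v v = 0 := by
  have := extD_swap hθ x v v
  linarith

/-- The complex tangent vector `A + i B` at `x` belongs to
`T_{1,0} = {X - i J X : X ∈ H}`, where `H = ker θ`. -/
def IsType10 (θ : Π x : M, TangentSpace 𝓘(ℝ, E) x →L[ℝ] ℝ)
    (J : Π x : M, TangentSpace 𝓘(ℝ, E) x →L[ℝ] TangentSpace 𝓘(ℝ, E) x) (x : M)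
    (A B : TangentSpace 𝓘(ℝ, E) x) : Prop :=
  θ x A = 0 ∧ B = -(J x A)

variable (E M) in
/-- A pseudo-Hermitian (strictly pseudoconvex) structure `(H, J, θ)` on `M`, with `H = ker θ`,
and with `J` extended to `TM` by `J ξ = 0`.  The CR structure is
`T_{1,0} = {X - i J X : X ∈ H}`. -/
structure PseudoHermitian where
  /-- the contact form -/
  θ : Π x : M, TangentSpace 𝓘(ℝ, E) x →L[ℝ] ℝ
  smooth_θ : SmoothForm θ
  θ_ne_zero : ∀ x, θ x ≠ 0
  /-- the complex structure of the Levi distribution, extended to `TM` -/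
  J : Π x : M, TangentSpace 𝓘(ℝ, E) x →L[ℝ] TangentSpace 𝓘(ℝ, E) x
  smooth_J : SmoothEnd J
  θ_J : ∀ x v, θ x (J x v) = 0
  J_sq : ∀ x v, θ x v = 0 → J x (J x v) = -v
  /-- `J` vanishes on the kernel of `dθ`, which is spanned by the Reeb vector. -/
  J_reeb : ∀ x v, (∀ w, extD θ smooth_θ x v w = 0) → J x v = 0
  /-- `[Γ(T_{1,0}), Γ(T_{1,0})] ⊆ Γ(T_{1,0})`, where
  `[A + i B, A' + i B'] = [A, A'] - [B, B'] + i ([A, B'] + [B, A'])`. -/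
  integrable : ∀ (x : M) (A B A' B' : VF E M),
    SmoothVFAt A x → SmoothVFAt B x → SmoothVFAt A' x → SmoothVFAt B' x →
    (∀ᶠ y in 𝓝 x, IsType10 θ J y (A y) (B y)) → (∀ᶠ y in 𝓝 x, IsType10 θ J y (A' y) (B' y)) →
    IsType10 θ J x (mlieBracket 𝓘(ℝ, E) A A' x - mlieBracket 𝓘(ℝ, E) B B' x)
      (mlieBracket 𝓘(ℝ, E) A B' x + mlieBracket 𝓘(ℝ, E) B A' x)
  /-- The Levi form `L_θ(X, Y) = dθ(X, J Y)` is positive definite on `H`. -/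
  levi_pos : ∀ x v, θ x v = 0 → v ≠ 0 → 0 < extD θ smooth_θ x v (J x v)

namespace PseudoHermitian

variable (S : PseudoHermitian E M)

/-- `dθ` -/
def dθ (x : M) : TangentSpace 𝓘(ℝ, E) x →L[ℝ] TangentSpace 𝓘(ℝ, E) x →L[ℝ] ℝ :=
  extD S.θ S.smooth_θ x

lemma reeb_aux (x : M) (v : TangentSpace 𝓘(ℝ, E) x)
    (h : ∀ w, S.θ x v * S.θ x w + S.dθ x v w = 0) : v = 0 := by
  have h1 := h v
  rw [dθ, extD_self] at h1
  have h2 : S.θ x v = 0 := by nlinarith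
  by_contra hv
  have h3 := S.levi_pos x v h2 hv
  have h4 := h (S.J x v)
  rw [h2, dθ] at h4
  linarith

lemma exists_reeb (x : M) :
    ∃! ξ : TangentSpace 𝓘(ℝ, E) x, S.θ x ξ = 1 ∧ ∀ w, S.dθ x ξ w = 0 := by
  have : FiniteDimensional ℝ (TangentSpace 𝓘(ℝ, E) x) := inferInstanceAs (FiniteDimensional ℝ E)
  let B : TangentSpace 𝓘(ℝ, E) x →ₗ[ℝ] Module.Dual ℝ (TangentSpace 𝓘(ℝ, E) x) :=
    LinearMap.mk₂ ℝ (fun v w => S.θ x v * S.θ x w + S.dθ x v w)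
      (by intros; simp; ring) (by intros; simp; ring) (by intros; simp; ring)
      (by intros; simp; ring)
  have hB : ∀ v w, B v w = S.θ x v * S.θ x w + S.dθ x v w := fun v w => rfl
  have hinj : Function.Injective B := by
    rw [injective_iff_map_eq_zero]
    intro v hv
    exact S.reeb_aux x v fun w => by rw [← hB, hv]; rfl
  have hsurj : Function.Surjective B :=
    (LinearMap.injective_iff_surjective_of_finrank_eq_finrank
      Subspace.dual_finrank_eq.symm).1 hinj
  obtain ⟨ξ, hξ⟩ := hsurj (S.θ x : TangentSpace 𝓘(ℝ, E) x →ₗ[ℝ] ℝ)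
  have hξ' : ∀ w, S.θ x ξ * S.θ x w + S.dθ x ξ w = S.θ x w := fun w => by rw [← hB, hξ]; rfl
  have h1 : S.θ x ξ = 1 := by
    have h1 := hξ' ξ
    have h0 : S.dθ x ξ ξ = 0 := extD_self _ _ _
    rw [h0] at h1
    by_contra hne
    have h2 : S.θ x ξ = 0 := by
      have : S.θ x ξ * (S.θ x ξ - 1) = 0 := by linarith
      rcases mul_eq_zero.1 this with h | h
      · exact h
      · exact absurd (by linarith) hne
    have h3 : ξ = 0 := by
      by_contra hne
      have h4 := S.levi_pos x ξ h2 hne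
      have h5 := hξ' (S.J x ξ)
      rw [S.θ_J, mul_zero, zero_add, dθ] at h5
      linarith
    apply S.θ_ne_zero x
    ext w
    rw [← hξ' w, h3]
    simp
  refine ⟨ξ, ⟨h1, fun w => ?_⟩, fun η hη => ?_⟩
  · have := hξ' w
    rw [h1] at this
    linarith
  · apply hinj
    ext w
    rw [hB, hB, hξ' w, hη.1, hη.2]
    ring

/-- The Reeb vector field `ξ`: `θ(ξ) = 1` and `dθ(ξ, ·) = 0`. -/
def reeb : VF E M := fun x => (S.exists_reeb x).choose

lemma θ_reeb (x : M) : S.θ x (S.reeb x) = 1 := (S.exists_reeb x).choose_spec.1.1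

lemma dθ_reeb (x : M) (w : TangentSpace 𝓘(ℝ, E) x) : S.dθ x (S.reeb x) w = 0 :=
  (S.exists_reeb x).choose_spec.1.2 w

/-- The projection `π_H` of `TM = H ⊕ L` onto the Levi distribution. -/
def projH (x : M) (v : TangentSpace 𝓘(ℝ, E) x) : TangentSpace 𝓘(ℝ, E) x :=
  v - S.θ x v • S.reeb x

/-- The projection `π_L` of `TM = H ⊕ L` onto the line bundle spanned by `ξ`. -/
def projL (x : M) (v : TangentSpace 𝓘(ℝ, E) x) : TangentSpace 𝓘(ℝ, E) x :=
  S.θ x v • S.reeb x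

/-- The Levi form `L_θ(X, Y) = dθ(X, J Y)`. -/
def levi (x : M) (v w : TangentSpace 𝓘(ℝ, E) x) : ℝ := S.dθ x v (S.J x w)

/-- The Webster metric `g_θ(X, Y) = L_θ(π_H X, π_H Y) + θ(X) θ(Y)`. -/
def metric (x : M) (v w : TangentSpace 𝓘(ℝ, E) x) : ℝ :=
  S.levi x (S.projH x v) (S.projH x w) + S.θ x v * S.θ x w

/-- The norm `|v|` induced by the Webster metric. -/
def vnorm (x : M) (v : TangentSpace 𝓘(ℝ, E) x) : ℝ := √(S.metric x v v)

lemma θ_projH (x : M) (v : TangentSpace 𝓘(ℝ, E) x) : S.θ x (S.projH x v) = 0 := by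
  simp [projH, θ_reeb]

lemma projH_of_mem {x : M} {v : TangentSpace 𝓘(ℝ, E) x} (h : S.θ x v = 0) :
    S.projH x v = v := by
  simp [projH, h]

/-- An extension of a horizontal vector `v` at `x` to a vector field that is smooth and
horizontal near `x`. -/
def hExt {x : M} (v : TangentSpace 𝓘(ℝ, E) x) : VF E M := fun y =>
  extend E v y - (S.θ y (extend E v y) / S.θ y (extend E (S.reeb x) y)) • extend E (S.reeb x) y

lemma hExt_self {x : M} {v : TangentSpace 𝓘(ℝ, E) x} (h : S.θ x v = 0) : S.hExt v x = v := by
  simp [hExt, h]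

lemma smooth_extend {x : M} (v : TangentSpace 𝓘(ℝ, E) x) :
    SmoothVFAt (extend E v : VF E M) x :=
  contMDiffAt_extend 𝓘(ℝ, E) E v

lemma eventually_ne {x : M} : ∀ᶠ y in 𝓝 x, S.θ y (extend E (S.reeb x) y) ≠ 0 := by
  have h := (S.smooth_θ.apply_smooth (smooth_extend (S.reeb x))).continuousAt
  apply h.eventually_ne
  simp [θ_reeb]

lemma hExt_horizontal {x : M} (v : TangentSpace 𝓘(ℝ, E) x) :
    ∀ᶠ y in 𝓝 x, S.θ y (S.hExt v y) = 0 := by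
  filter_upwards [S.eventually_ne] with y hy
  simp [hExt, hy]

lemma smooth_hExt {x : M} (v : TangentSpace 𝓘(ℝ, E) x) : SmoothVFAt (S.hExt v) x := by
  have h1 := smooth_extend v
  have h2 := smooth_extend (S.reeb x)
  have h3 := (S.smooth_θ.apply_smooth h1).div₀ (S.smooth_θ.apply_smooth h2) (by simp [θ_reeb])
  exact ContMDiffAt.sub_section h1 (ContMDiffAt.smul_section h3 h2)

lemma dθ_of_horizontal {x : M} {X Y : VF E M} (hX : DiffVFAt X x) (hY : DiffVFAt Y x)
    (hX' : ∀ᶠ y in 𝓝 x, S.θ y (X y) = 0) (hY' : ∀ᶠ y in 𝓝 x, S.θ y (Y y) = 0) :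
    S.dθ x (X x) (Y x) = -(1 / 2 : ℝ) * S.θ x (mlieBracket 𝓘(ℝ, E) X Y x) := by
  have key : ∀ Z : VF E M, (∀ᶠ y in 𝓝 x, S.θ y (Z y) = 0) →
      mvfderiv 𝓘(ℝ, E) (fun y => S.θ y (Z y)) x = 0 := by
    intro Z hZ
    have h : (fun y => S.θ y (Z y)) =ᶠ[𝓝 x] fun _ => (0 : ℝ) := hZ
    have h2 := h.mfderiv_eq (I := 𝓘(ℝ, E)) (I' := 𝓘(ℝ, ℝ))
    have h3 : mvfderiv 𝓘(ℝ, E) (fun _ : M => (0 : ℝ)) x = 0 := mvfderiv_const _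
    rw [← h3]
    unfold mvfderiv
    rw [h2]
    rfl
  rw [dθ, extD_apply S.smooth_θ hX hY, dAux, key X hX', key Y hY']
  simp

lemma dθ_J {x : M} {v w : TangentSpace 𝓘(ℝ, E) x} (hv : S.θ x v = 0) (hw : S.θ x w = 0) :
    S.dθ x (S.J x v) (S.J x w) = S.dθ x v w := by
  have s1 := S.smooth_hExt v
  have s2 := S.smooth_hExt w
  have s3 : SmoothVFAt (fun y => -(S.J y (S.hExt v y))) x :=
    ContMDiffAt.neg_section (S.smooth_J.apply s1)
  have s4 : SmoothVFAt (fun y => -(S.J y (S.hExt w y))) x :=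
    ContMDiffAt.neg_section (S.smooth_J.apply s2)
  have h1 := S.integrable x _ _ _ _ s1 s3 s2 s4
    ((S.hExt_horizontal v).mono fun y hy => ⟨hy, rfl⟩)
    ((S.hExt_horizontal w).mono fun y hy => ⟨hy, rfl⟩)
  have h2 := S.dθ_of_horizontal s1.diff s2.diff (S.hExt_horizontal v) (S.hExt_horizontal w)
  have h3 := S.dθ_of_horizontal s3.diff s4.diff
    (Eventually.of_forall fun y => by rw [map_neg, S.θ_J, neg_zero])
    (Eventually.of_forall fun y => by rw [map_neg, S.θ_J, neg_zero])
  have h4 := h1.1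
  rw [map_sub] at h4
  simp only [S.hExt_self hv, S.hExt_self hw, map_neg, neg_neg,
    _root_.neg_apply] at h2 h3
  rw [h2, h3]
  linarith

lemma levi_symm {x : M} {v w : TangentSpace 𝓘(ℝ, E) x} (hv : S.θ x v = 0) (hw : S.θ x w = 0) :
    S.levi x v w = S.levi x w v := by
  have h1 := S.dθ_J hv (S.θ_J x w)
  rw [S.J_sq x w hw, map_neg, dθ, extD_swap, neg_neg] at h1
  exact h1.symm

lemma metric_symm (x : M) (v w : TangentSpace 𝓘(ℝ, E) x) : S.metric x v w = S.metric x w v := by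
  rw [metric, metric, S.levi_symm (S.θ_projH x v) (S.θ_projH x w)]
  ring

lemma metric_add_left (x : M) (v v' w : TangentSpace 𝓘(ℝ, E) x) :
    S.metric x (v + v') w = S.metric x v w + S.metric x v' w := by
  have : S.projH x (v + v') = S.projH x v + S.projH x v' := by
    simp only [projH, map_add, add_smul]; abel
  simp [metric, levi, this]
  ring

lemma metric_smul_left (x : M) (c : ℝ) (v w : TangentSpace 𝓘(ℝ, E) x) :
    S.metric x (c • v) w = c * S.metric x v w := by
  have : S.projH x (c • v) = c • S.projH x v := by
    simp only [projH, map_smul, smul_sub, smul_smul, smul_eq_mul]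
  simp [metric, levi, this]
  ring

lemma metric_pos (x : M) {v : TangentSpace 𝓘(ℝ, E) x} (hv : v ≠ 0) : 0 < S.metric x v v := by
  by_cases h : S.projH x v = 0
  · have h1 : S.θ x v ≠ 0 := by
      intro h0
      rw [S.projH_of_mem h0] at h
      exact hv h
    have : 0 < S.θ x v * S.θ x v := mul_self_pos.2 h1
    simpa [metric, levi, h] using this
  · have h1 := S.levi_pos x _ (S.θ_projH x v) h
    have h2 := mul_self_nonneg (S.θ x v)
    unfold metric levi dθ
    linarith

/-- The Webster metric at `x` as a bilinear form. -/
def metricForm (x : M) : LinearMap.BilinForm ℝ (TangentSpace 𝓘(ℝ, E) x) :=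
  LinearMap.mk₂ ℝ (S.metric x) (S.metric_add_left x) (S.metric_smul_left x)
    (fun v w w' => by rw [S.metric_symm, S.metric_add_left, S.metric_symm x w, S.metric_symm x w'])
    (fun c v w => by rw [S.metric_symm, S.metric_smul_left, S.metric_symm x w]; rfl)

/-- The Webster metric at `x` as an inner product. -/
@[reducible] def core (x : M) : InnerProductSpace.Core ℝ (TangentSpace 𝓘(ℝ, E) x) where
  inner v w := S.metric x v w
  conj_inner_symm v w := S.metric_symm x w v
  re_inner_nonneg v := by
    by_cases h : v = 0
    · simp [h, metric, levi, projH]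
    · exact (S.metric_pos x h).le
  add_left := S.metric_add_left x
  smul_left v w c := S.metric_smul_left x c v w
  definite v h := by
    by_contra hv
    exact (S.metric_pos x hv).ne' h

/-- The gradient `∇u` for the Webster metric exists and is unique. -/
lemma exists_grad (u : M → ℝ) (x : M) :
    ∃! w : TangentSpace 𝓘(ℝ, E) x, ∀ v, S.metric x w v = mvfderiv 𝓘(ℝ, E) u x v := by
  have : FiniteDimensional ℝ (TangentSpace 𝓘(ℝ, E) x) := inferInstanceAs (FiniteDimensional ℝ E)
  have hinj : Function.Injective (S.metricForm x) := by
    rw [injective_iff_map_eq_zero]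
    intro v hv
    by_contra hne
    have h1 := S.metric_pos x hne
    have h2 : S.metricForm x v v = 0 := by rw [hv]; rfl
    exact h1.ne' h2
  have hsurj : Function.Surjective (S.metricForm x) :=
    (LinearMap.injective_iff_surjective_of_finrank_eq_finrank
      Subspace.dual_finrank_eq.symm).1 hinj
  obtain ⟨w, hw⟩ :=
    hsurj (mvfderiv 𝓘(ℝ, E) u x : TangentSpace 𝓘(ℝ, E) x →ₗ[ℝ] ℝ)
  refine ⟨w, fun v => congrArg (fun f => f v) hw, fun w' hw' => ?_⟩
  apply hinj
  rw [hw]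
  ext v
  exact hw' v

/-- The gradient `∇u` of `u` for the Webster metric. -/
def grad (u : M → ℝ) : VF E M := fun x => (S.exists_grad u x).choose

lemma metric_grad (u : M → ℝ) (x : M) (v : TangentSpace 𝓘(ℝ, E) x) :
    S.metric x (S.grad u x) v = mvfderiv 𝓘(ℝ, E) u x v :=
  (S.exists_grad u x).choose_spec.1 v

/-- The horizontal gradient `∇^H u = π_H (∇u)`. -/
def gradH (u : M → ℝ) : VF E M := fun x => S.projH x (S.grad u x)

/-- The vertical gradient `∇^L u = π_L (∇u)`. -/
def gradL (u : M → ℝ) : VF E M := fun x => S.projL x (S.grad u x)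

/-- The Levi distribution `H = ker θ` at `x`. -/
def H (x : M) : Submodule ℝ (TangentSpace 𝓘(ℝ, E) x) :=
  LinearMap.ker (S.θ x : TangentSpace 𝓘(ℝ, E) x →ₗ[ℝ] ℝ)

lemma mem_H {x : M} {v : TangentSpace 𝓘(ℝ, E) x} : v ∈ S.H x ↔ S.θ x v = 0 := Iff.rfl

lemma exists_frame (x : M) :
    ∃ e : Fin (Module.finrank ℝ (S.H x)) → TangentSpace 𝓘(ℝ, E) x,
      (∀ i, S.θ x (e i) = 0) ∧ (∀ i j, S.metric x (e i) (e j) = if i = j then 1 else 0) ∧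
      ∀ v, S.θ x v = 0 → v = ∑ i, S.metric x (e i) v • e i := by
  have : FiniteDimensional ℝ (TangentSpace 𝓘(ℝ, E) x) := inferInstanceAs (FiniteDimensional ℝ E)
  let c : InnerProductSpace.Core ℝ (S.H x) :=
    { inner := fun v w => S.metric x v w
      conj_inner_symm := fun v w => (S.core x).conj_inner_symm v w
      re_inner_nonneg := fun v => (S.core x).re_inner_nonneg v
      add_left := fun v w z => (S.core x).add_left v w z
      smul_left := fun v w r => (S.core x).smul_left v w r
      definite := fun v h => Subtype.ext ((S.core x).definite v h) }
  let _ : NormedAddCommGroup (S.H x) := c.toNormedAddCommGroup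
  let _ : InnerProductSpace ℝ (S.H x) := InnerProductSpace.ofCore c.toCore
  let b := stdOrthonormalBasis ℝ (S.H x)
  have hin : ∀ v w : S.H x, inner ℝ v w = S.metric x v w := fun v w => rfl
  refine ⟨fun i => (b i : TangentSpace 𝓘(ℝ, E) x), fun i => (b i).2, fun i j => ?_,
    fun v hv => ?_⟩
  · rw [← hin]
    exact orthonormal_iff_ite.1 b.orthonormal i j
  · have h := b.sum_repr' ⟨v, hv⟩
    have h2 := congrArg Subtype.val h
    simpa [hin] using h2.symm

/-- An orthonormal basis of the Levi distribution `H` at `x`. -/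
def frame (x : M) : Fin (Module.finrank ℝ (S.H x)) → TangentSpace 𝓘(ℝ, E) x :=
  (S.exists_frame x).choose

lemma θ_frame (x : M) (i) : S.θ x (S.frame x i) = 0 := (S.exists_frame x).choose_spec.1 i

lemma frame_orthonormal (x : M) (i j) :
    S.metric x (S.frame x i) (S.frame x j) = if i = j then 1 else 0 :=
  (S.exists_frame x).choose_spec.2.1 i j

lemma sum_frame {x : M} {v : TangentSpace 𝓘(ℝ, E) x} (hv : S.θ x v = 0) :
    v = ∑ i, S.metric x (S.frame x i) v • S.frame x i :=
  (S.exists_frame x).choose_spec.2.2 v hv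

/-- The value `g(∇_X Y, Z)` at `x` of the Tanaka-Webster connection `∇` on horizontal vector
fields, as given by the Koszul formula (`g` is parallel and the torsion of two horizontal fields
is orthogonal to `H`). -/
def koszul (X Y Z : VF E M) (x : M) : ℝ :=
  (1 / 2 : ℝ) * (mvfderiv 𝓘(ℝ, E) (fun y => S.metric y (Y y) (Z y)) x (X x)
    + mvfderiv 𝓘(ℝ, E) (fun y => S.metric y (X y) (Z y)) x (Y x)
    - mvfderiv 𝓘(ℝ, E) (fun y => S.metric y (X y) (Y y)) x (Z x)
    + S.metric x (mlieBracket 𝓘(ℝ, E) X Y x) (Z x)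
    - S.metric x (mlieBracket 𝓘(ℝ, E) X Z x) (Y x)
    - S.metric x (mlieBracket 𝓘(ℝ, E) Y Z x) (X x))

/-- The Tanaka-Webster covariant derivative `∇_X Y` of horizontal vector fields. -/
def nablaH (X Y : VF E M) : VF E M := fun x =>
  ∑ i, S.koszul X Y (S.hExt (S.frame x i)) x • S.frame x i

/-- The Hessian `(∇du)(Y, Z) = Y(Z u) - (∇_Y Z) u` of the Tanaka-Webster connection at horizontal
vectors `v, w`, evaluated on horizontal extensions of these vectors (the Hessian is a tensor, so the choice of the
extensions is immaterial). -/
def hess (u : M → ℝ) (x : M) (v w : TangentSpace 𝓘(ℝ, E) x) : ℝ :=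
  mvfderiv 𝓘(ℝ, E) (fun y => mvfderiv 𝓘(ℝ, E) u y (S.hExt w y)) x v
    - mvfderiv 𝓘(ℝ, E) u x (S.nablaH (S.hExt v) (S.hExt w) x)

/-- The sub-Laplacian `Δ_b u = trace_H (∇du)`. -/
def subLaplacian (u : M → ℝ) (x : M) : ℝ :=
  ∑ i, S.hess u x (S.frame x i) (S.frame x i)

/-- The axioms characterizing the Tanaka-Webster connection: it preserves `H`, `J` and `g_θ` are
parallel, and the torsion `T` satisfies `T(X, Y) = 2 dθ(X, Y) ξ` and
`T(ξ, J X) + J T(ξ, X) = 0` on `H`. -/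
structure IsTanakaWebster
    (cov : CovariantDerivative 𝓘(ℝ, E) E (TangentSpace 𝓘(ℝ, E) : M → Type _)) : Prop where
  preserves_H : ∀ (x : M) (Y : VF E M), DiffVFAt Y x → (∀ᶠ y in 𝓝 x, S.θ y (Y y) = 0) →
    ∀ v, S.θ x (cov Y x v) = 0
  parallel_J : ∀ (x : M) (Y : VF E M), DiffVFAt Y x →
    ∀ v, cov (fun y => S.J y (Y y)) x v = S.J x (cov Y x v)
  parallel_metric : ∀ (x : M) (Y Z : VF E M), DiffVFAt Y x → DiffVFAt Z x → ∀ v,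
    mvfderiv 𝓘(ℝ, E) (fun y => S.metric y (Y y) (Z y)) x v
      = S.metric x (cov Y x v) (Z x) + S.metric x (Y x) (cov Z x v)
  torsion_H : ∀ (x : M) (X Y : VF E M), DiffVFAt X x → DiffVFAt Y x →
    S.θ x (X x) = 0 → S.θ x (Y x) = 0 →
    cov Y x (X x) - cov X x (Y x) - mlieBracket 𝓘(ℝ, E) X Y x
      = (2 * S.dθ x (X x) (Y x)) • S.reeb x
  torsion_pure : ∀ (x : M) (N X Y : VF E M), DiffVFAt N x → DiffVFAt X x → DiffVFAt Y x →
    N x = S.reeb x → S.θ x (X x) = 0 → Y x = S.J x (X x) →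
    (cov Y x (N x) - cov N x (Y x) - mlieBracket 𝓘(ℝ, E) N Y x)
      + S.J x (cov X x (N x) - cov N x (X x) - mlieBracket 𝓘(ℝ, E) N X x) = 0

lemma metric_reeb_left {x : M} {w : TangentSpace 𝓘(ℝ, E) x} (hw : S.θ x w = 0) :
    S.metric x (S.reeb x) w = 0 := by
  simp [metric, levi, projH, θ_reeb, hw]

variable {S} in
/-- A connection satisfying the Tanaka-Webster axioms agrees on horizontal vector fields with
`nablaH`. -/
theorem IsTanakaWebster.eq_nablaH
    {cov : CovariantDerivative 𝓘(ℝ, E) E (TangentSpace 𝓘(ℝ, E) : M → Type _)}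
    (h : S.IsTanakaWebster cov) {x : M} {X Y : VF E M} (hX : DiffVFAt X x) (hY : DiffVFAt Y x)
    (hX' : ∀ᶠ y in 𝓝 x, S.θ y (X y) = 0) (hY' : ∀ᶠ y in 𝓝 x, S.θ y (Y y) = 0) :
    cov Y x (X x) = S.nablaH X Y x := by
  rw [S.sum_frame (h.preserves_H x Y hY hY' (X x)), nablaH]
  refine Finset.sum_congr rfl fun i _ => ?_
  congr 1
  set Z := S.hExt (S.frame x i) with hZdef
  have hZ : DiffVFAt Z x := (S.smooth_hExt _).diff
  have hZ' : ∀ᶠ y in 𝓝 x, S.θ y (Z y) = 0 := S.hExt_horizontal _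
  have hZx : Z x = S.frame x i := S.hExt_self (S.θ_frame x i)
  have tor : ∀ A B C : VF E M, DiffVFAt A x → DiffVFAt B x → S.θ x (A x) = 0 →
      S.θ x (B x) = 0 → S.θ x (C x) = 0 →
      S.metric x (mlieBracket 𝓘(ℝ, E) A B x) (C x)
        = S.metric x (cov B x (A x)) (C x) - S.metric x (cov A x (B x)) (C x) := by
    intro A B C hA hB hA' hB' hC'
    have e : cov B x (A x) = mlieBracket 𝓘(ℝ, E) A B x + cov A x (B x)
        + (2 * S.dθ x (A x) (B x)) • S.reeb x := by
      rw [← h.torsion_H x A B hA hB hA' hB']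
      abel
    rw [e, S.metric_add_left, S.metric_add_left, S.metric_smul_left, S.metric_reeb_left hC']
    ring
  have x1 := hX'.self_of_nhds
  have x2 := hY'.self_of_nhds
  have x3 := hZ'.self_of_nhds
  rw [koszul, h.parallel_metric x Y Z hY hZ, h.parallel_metric x X Z hX hZ,
    h.parallel_metric x X Y hX hY, tor X Y Z hX hY x1 x2 x3, tor X Z Y hX hZ x1 x3 x2,
    tor Y Z X hY hZ x2 x3 x1, ← hZx, S.metric_symm x (Z x) (cov Y x (X x)),
    S.metric_symm x (Y x) (cov Z x (X x)), S.metric_symm x (X x) (cov Z x (Y x)),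
    S.metric_symm x (X x) (cov Y x (Z x))]
  ring

variable {S} in
/-- `Δ_b u` is the trace over `H` of `(Y, Z) ↦ Y(Z u) - (∇_Y Z) u`, where `∇` is the
Tanaka-Webster connection. -/
theorem IsTanakaWebster.subLaplacian_eq
    {cov : CovariantDerivative 𝓘(ℝ, E) E (TangentSpace 𝓘(ℝ, E) : M → Type _)}
    (h : S.IsTanakaWebster cov) (u : M → ℝ) (x : M) :
    S.subLaplacian u x = ∑ i,
      (mvfderiv 𝓘(ℝ, E) (fun y => mvfderiv 𝓘(ℝ, E) u y (S.hExt (S.frame x i) y)) x (S.frame x i)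
        - mvfderiv 𝓘(ℝ, E) u x (cov (S.hExt (S.frame x i)) x (S.frame x i))) := by
  refine Finset.sum_congr rfl fun i _ => ?_
  have hs := (S.smooth_hExt (S.frame x i)).diff
  have hh := S.hExt_horizontal (S.frame x i)
  have e := h.eq_nablaH hs hs hh hh
  rw [S.hExt_self (S.θ_frame x i)] at e
  rw [hess, ← e]

end PseudoHermitian

end CR

end

/-! Everything rests on one Omori–Yau principle, `exists_almost_max`. Let `g` be increasing and let
`g(u)` be bounded above. Given `o` and `δ > 0`, there is a point `x` with `u(o) ≤ u(x)` at which
`g'(u)|∇^H u|`, `g'(u)|∇^L u|` and `g'(u) Δ_b u + g''(u)|∇^H u|²` are all at most `δ`. To find `x`,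
maximize `g(u) - η χ(γ)` with `χ(s) = ∫ G^{-1/2}` up to `√s` and `η` small. Non-integrability of
`G^{-1/2}` makes `χ(γ)` proper. The bounds on `|∇γ|` and `Δ_b γ`, with the concavity of `χ`, bound
`|∇χ(γ)|` and bound `Δ_b χ(γ)` from above. Since `Δ_b` is a trace over `H`, the second order
condition at the maximum is needed only along horizontal directions.

If `sup u` is finite and `f(sup u) > 0`, take `g = id`. The points found have `u` near `sup u`,
small gradients and `Δ_b u ≤ δ`, whereas convexity of `φ` in `(x₁, x₂)` keeps `φ(u, |∇^L u|, |∇^H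
u|)` above a positive constant (`exists_pos_lt_of_pos_corner`).

If `sup u = +∞` and `liminf f/F > 0`, write `P(t) = ∫_a^t F` and take the Keller–Osserman function
`g(t) = ∫_b^t P^{-1/2}`, which is bounded. Here `g' = P^{-1/2} =: p` and `g'' = -F p³/2`. By
convexity, `φ` lies above its linearization at the corner, and the liminf conditions bound the
slopes below by `-K F p`. Multiplied by `p`, the inequality for `u` becomes `F p (c - K₁ p|∇^L u| -
K₂ p|∇^H u| - (p|∇^H u|)²/2) ≤ δ`. The growth conditions on `F` give `F p ≥ κ > 0`
(`exists_pos_le_mul_integral_rpow`), which is impossible for small `δ`. -/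

set_option linter.unusedSectionVars false

namespace CR

/-! ### Second derivatives in coordinates and curves realizing the Hessian -/

section Chart

variable {E : Type*} [NormedAddCommGroup E] [NormedSpace ℝ E]
  {M : Type*} [TopologicalSpace M] [ChartedSpace E M] [IsManifold 𝓘(ℝ, E) ∞ M]

/-- The derivative of a function, computed in the chart at a nearby point `x`. -/
lemma mvfderiv_eq_fderiv_chart {f : M → ℝ} {x y : M} (hy : y ∈ (extChartAt 𝓘(ℝ, E) x).source)
    (hf : DifferentiableAt ℝ (f ∘ (extChartAt 𝓘(ℝ, E) x).symm) (extChartAt 𝓘(ℝ, E) x y))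
    (w : TangentSpace 𝓘(ℝ, E) y) :
    mvfderiv 𝓘(ℝ, E) f y w = fderiv ℝ (f ∘ (extChartAt 𝓘(ℝ, E) x).symm)
      (extChartAt 𝓘(ℝ, E) x y) (mfderiv 𝓘(ℝ, E) 𝓘(ℝ, E) (extChartAt 𝓘(ℝ, E) x) y w) := by
  have : IsManifold 𝓘(ℝ, E) 1 M := IsManifold.of_le (n := ∞) (by simp)
  have h1 : f =ᶠ[𝓝 y] (f ∘ (extChartAt 𝓘(ℝ, E) x).symm) ∘ extChartAt 𝓘(ℝ, E) x := by
    filter_upwards [(isOpen_extChartAt_source (I := 𝓘(ℝ, E)) x).mem_nhds hy] with z hz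
    exact congrArg f ((extChartAt 𝓘(ℝ, E) x).left_inv hz).symm
  have h2 : MDifferentiableAt 𝓘(ℝ, E) 𝓘(ℝ, E) (extChartAt 𝓘(ℝ, E) x) y :=
    mdifferentiableAt_extChartAt (by simpa using hy)
  have h3 := h1.mfderiv_eq (I := 𝓘(ℝ, E)) (I' := 𝓘(ℝ, ℝ))
  rw [mfderiv_comp y hf.mdifferentiableAt h2, mfderiv_eq_fderiv] at h3
  exact congrArg (fun L => L w) h3

/-- The coordinate expression of a smooth vector field is smooth. -/
lemma SmoothVFAt.chart {X : VF E M} {x : M} (hX : SmoothVFAt X x) :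
    ∃ Y : E → E, DifferentiableAt ℝ Y (extChartAt 𝓘(ℝ, E) x x) ∧
      ∀ᶠ y in 𝓝 x, mfderiv 𝓘(ℝ, E) 𝓘(ℝ, E) (extChartAt 𝓘(ℝ, E) x) y (X y)
        = Y (extChartAt 𝓘(ℝ, E) x y) := by
  have : IsManifold 𝓘(ℝ, E) 1 M := IsManifold.of_le (n := ∞) (by simp)
  have h := (contMDiffAt_section (IB := 𝓘(ℝ, E)) x).1 hX
  refine ⟨fun z => (fun q : M => (trivializationAt E (TangentSpace 𝓘(ℝ, E)) x
      ⟨q, X q⟩).2) ((extChartAt 𝓘(ℝ, E) x).symm z),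
    ((contMDiffAt_iff.1 h).2.contDiffAt (by simp)).differentiableAt (by simp), ?_⟩
  filter_upwards [extChartAt_source_mem_nhds (I := 𝓘(ℝ, E)) x] with y hy
  have hy' : y ∈ (chartAt E x).source := by simpa using hy
  rw [← TangentBundle.continuousLinearMapAt_trivializationAt hy']
  refine Eq.trans ?_ (congrArg (fun q : M => (trivializationAt E (TangentSpace 𝓘(ℝ, E)) x
      ⟨q, X q⟩).2) ((extChartAt 𝓘(ℝ, E) x).left_inv hy)).symm
  exact congrFun (Trivialization.coe_linearMapAt_of_mem (R := ℝ)
    (trivializationAt E (TangentSpace 𝓘(ℝ, E)) x) (by simpa using hy')) (X y)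

/-- The coordinate expression of `X(Xw)`. -/
lemma mvfderiv_mvfderiv_chart {X : VF E M} {x : M} (hX : SmoothVFAt X x) :
    ∃ ζ : E, ∀ w : M → ℝ, ContMDiffAt 𝓘(ℝ, E) 𝓘(ℝ, ℝ) 2 w x →
      mvfderiv 𝓘(ℝ, E) (fun y => mvfderiv 𝓘(ℝ, E) w y (X y)) x (X x)
        = fderiv ℝ (fderiv ℝ (w ∘ (extChartAt 𝓘(ℝ, E) x).symm)) (extChartAt 𝓘(ℝ, E) x x)
          (mfderiv 𝓘(ℝ, E) 𝓘(ℝ, E) (extChartAt 𝓘(ℝ, E) x) x (X x))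
          (mfderiv 𝓘(ℝ, E) 𝓘(ℝ, E) (extChartAt 𝓘(ℝ, E) x) x (X x))
        + fderiv ℝ (w ∘ (extChartAt 𝓘(ℝ, E) x).symm) (extChartAt 𝓘(ℝ, E) x x) ζ := by
  obtain ⟨Y, hY, hXY⟩ := hX.chart
  set e := extChartAt 𝓘(ℝ, E) x with he
  set ξ : E := mfderiv 𝓘(ℝ, E) 𝓘(ℝ, E) e x (X x) with hξ
  have hYx : Y (e x) = ξ := hXY.self_of_nhds.symm
  -- The first order part of `X(Xw)` is the derivative of the coordinate field along itself. It does
  -- not depend on `w`, so one choice serves all functions.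
  refine ⟨fderiv ℝ Y (e x) ξ, fun w hw => ?_⟩
  set W := w ∘ e.symm with hW
  have hWc : ContDiffAt ℝ 2 W (e x) := (contMDiffAt_iff.1 hw).2.contDiffAt (by simp)
  have hWe : ∀ᶠ z in 𝓝 (e x), DifferentiableAt ℝ W z :=
    (hWc.eventually (by simp)).mono fun z hz => hz.differentiableAt (by simp)
  have hex : ContinuousAt e x := continuousAt_extChartAt (I := 𝓘(ℝ, E)) x
  have hsymm : ContinuousAt e.symm (e x) := continuousAt_extChartAt_symm (I := 𝓘(ℝ, E)) x
  have hleft : e.symm (e x) = x := extChartAt_to_inv (I := 𝓘(ℝ, E)) x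
  have h1 : ∀ᶠ y in 𝓝 x, mvfderiv 𝓘(ℝ, E) w y (X y) = fderiv ℝ W (e y) (Y (e y)) := by
    filter_upwards [hXY, hex.eventually hWe, extChartAt_source_mem_nhds (I := 𝓘(ℝ, E)) x]
      with y h1 h2 h3
    rw [mvfderiv_eq_fderiv_chart h3 h2, h1]
  have h2 : ((fun y => mvfderiv 𝓘(ℝ, E) w y (X y)) ∘ e.symm)
      =ᶠ[𝓝 (e x)] fun z => fderiv ℝ W z (Y z) := by
    have h3 := hsymm.tendsto
    rw [hleft] at h3
    filter_upwards [h3.eventually h1, extChartAt_target_mem_nhds (I := 𝓘(ℝ, E)) x] with z hz hz'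
    simp only [Function.comp, hz, e.right_inv hz']
  have h4 : DifferentiableAt ℝ (fderiv ℝ W) (e x) :=
    (hWc.fderiv_right (m := 1) (by norm_num)).differentiableAt (by simp)
  have h5 : HasFDerivAt (fun z => fderiv ℝ W z (Y z)) _ (e x) :=
    h4.hasFDerivAt.clm_apply hY.hasFDerivAt
  have h6 := h5.congr_of_eventuallyEq h2
  rw [mvfderiv_eq_fderiv_chart (mem_extChartAt_source (I := 𝓘(ℝ, E)) x) h6.differentiableAt,
    h6.fderiv, ← he, ← hξ, hYx]
  exact add_comm _ _

lemma hasDerivAt_quadratic (p ξ ζ : E) (s : ℝ) :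
    HasDerivAt (fun s : ℝ => p + s • ξ + (s ^ 2 / 2) • ζ) (ξ + s • ζ) s := by
  have h1 : HasDerivAt (fun s : ℝ => s ^ 2 / 2) s s := by
    simpa using (hasDerivAt_pow 2 s).div_const 2
  exact ((((hasDerivAt_id s).smul_const ξ).const_add p).add (h1.smul_const ζ)).congr_deriv
    (by rw [one_smul])

end Chart

namespace PseudoHermitian

variable {E : Type*} [NormedAddCommGroup E] [NormedSpace ℝ E]
  {M : Type*} [TopologicalSpace M] [ChartedSpace E M] [IsManifold 𝓘(ℝ, E) ∞ M]
  [FiniteDimensional ℝ E] (S : PseudoHermitian E M)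

/-- Along a suitable curve through `x`, the first and second derivatives of a function are its
differential and its Tanaka-Webster Hessian in a given horizontal direction. -/
lemma exists_curve {x : M} {v : TangentSpace 𝓘(ℝ, E) x} (hv : S.θ x v = 0) :
    ∃ c : ℝ → M, c 0 = x ∧ ContinuousAt c 0 ∧
      ∀ w : M → ℝ, ContMDiffAt 𝓘(ℝ, E) 𝓘(ℝ, ℝ) 2 w x →
        ∃ w' : ℝ → ℝ, (∀ᶠ s in 𝓝 0, HasDerivAt (fun s => w (c s)) (w' s) s) ∧
          w' 0 = mvfderiv 𝓘(ℝ, E) w x v ∧ HasDerivAt w' (S.hess w x v v) 0 := by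
  obtain ⟨ζ, hζ⟩ := mvfderiv_mvfderiv_chart (S.smooth_hExt v)
  rw [S.hExt_self hv] at hζ
  set e := extChartAt 𝓘(ℝ, E) x with he
  set D := mfderiv 𝓘(ℝ, E) 𝓘(ℝ, E) e x with hD
  set N := S.nablaH (S.hExt v) (S.hExt v) x with hN
  set ξ : E := D v with hξ
  set ν : E := D N with hν
  -- The acceleration of the coordinate curve: `ζ` produces `X(Xw)`, and subtracting the coordinates
  -- of `∇_X X` turns it into the Hessian in the direction `v`.
  set η : E := ζ - ν with hη
  have hsymm : ContinuousAt e.symm (e x) := continuousAt_extChartAt_symm (I := 𝓘(ℝ, E)) x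
  have hq : ∀ s, HasDerivAt (fun s : ℝ => e x + s • ξ + (s ^ 2 / 2) • η) (ξ + s • η) s :=
    hasDerivAt_quadratic (e x) ξ η
  have hq0 : e x + (0 : ℝ) • ξ + ((0 : ℝ) ^ 2 / 2) • η = e x := by simp
  refine ⟨fun s => e.symm (e x + s • ξ + (s ^ 2 / 2) • η), ?_, ?_, fun w hw => ?_⟩
  · simp only [hq0]
    exact extChartAt_to_inv (I := 𝓘(ℝ, E)) x
  · exact ContinuousAt.comp (by rw [hq0]; exact hsymm) (hq 0).continuousAt
  set W := w ∘ e.symm with hW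
  have hWc : ContDiffAt ℝ 2 W (e x) := (contMDiffAt_iff.1 hw).2.contDiffAt (by simp)
  have hWe : ∀ᶠ z in 𝓝 (e x), DifferentiableAt ℝ W z :=
    (hWc.eventually (by simp)).mono fun z hz => hz.differentiableAt (by simp)
  have hx := mem_extChartAt_source (I := 𝓘(ℝ, E)) x
  have hd : ∀ a, mvfderiv 𝓘(ℝ, E) w x a = fderiv ℝ W (e x) (D a) := fun a =>
    mvfderiv_eq_fderiv_chart hx hWe.self_of_nhds a
  refine ⟨fun s => fderiv ℝ W (e x + s • ξ + (s ^ 2 / 2) • η) (ξ + s • η), ?_, ?_, ?_⟩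
  · have h := (hq 0).continuousAt.tendsto
    rw [hq0] at h
    filter_upwards [h.eventually hWe] with s hs
    exact hs.hasFDerivAt.comp_hasDerivAt s (hq s)
  · beta_reduce
    rw [hq0, hd, zero_smul]
    exact congrArg _ (add_zero ξ)
  · have h4 : DifferentiableAt ℝ (fderiv ℝ W) (e x) :=
      (hWc.fderiv_right (m := 1) (by norm_num)).differentiableAt (by simp)
    have h5 : HasDerivAt (fun s : ℝ => fderiv ℝ W (e x + s • ξ + (s ^ 2 / 2) • η))
        (fderiv ℝ (fderiv ℝ W) (e x) (ξ + (0 : ℝ) • η)) 0 :=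
      HasFDerivAt.comp_hasDerivAt (0 : ℝ) (by rw [hq0]; exact h4.hasFDerivAt) (hq 0)
    have h6 : HasDerivAt (fun s : ℝ => ξ + s • η) η 0 := by
      simpa using ((hasDerivAt_id (0 : ℝ)).smul_const η).const_add ξ
    have h7 := h5.clm_apply h6
    refine h7.congr_deriv ?_
    rw [hess, hζ w hw, hd, hq0, hη, map_sub, zero_smul, add_zero]
    exact (add_sub_assoc _ _ _).symm

end PseudoHermitian
end CR

/-! ### First and second order conditions at a local maximum -/

/-- The necessary second order condition at a local maximum. -/
lemma IsLocalMax.second_deriv_nonpos {f f' : ℝ → ℝ} {a f'' : ℝ} (h : IsLocalMax f a)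
    (hf : ∀ᶠ t in 𝓝 a, HasDerivAt f (f' t) t) (hf' : HasDerivAt f' f'' a) : f'' ≤ 0 := by
  by_contra! hpos
  have h1 : deriv f =ᶠ[𝓝 a] f' := hf.mono fun t ht => ht.deriv
  have h2 : deriv (deriv f) a = f'' := by rw [h1.deriv_eq, hf'.deriv]
  -- With `f'' > 0` the point would also be a local minimum, so `f` would be locally constant and
  -- `f''` would vanish.
  have h3 := isLocalMin_of_deriv_deriv_pos (by rwa [h2]) h.deriv_eq_zero
    hf.self_of_nhds.continuousAt
  have h4 : f =ᶠ[𝓝 a] fun _ => f a := by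
    filter_upwards [h, h3] with t h5 h6 using le_antisymm h5 h6
  have h5 : deriv (deriv f) a = 0 := by
    rw [h4.deriv.deriv_eq]
    simp
  linarith

namespace CR
namespace PseudoHermitian

variable {E : Type*} [NormedAddCommGroup E] [NormedSpace ℝ E]
  {M : Type*} [TopologicalSpace M] [ChartedSpace E M] [IsManifold 𝓘(ℝ, E) ∞ M]
  [FiniteDimensional ℝ E] (S : PseudoHermitian E M)

lemma metric_self_nonneg (x : M) (v : TangentSpace 𝓘(ℝ, E) x) : 0 ≤ S.metric x v v :=
  (S.core x).re_inner_nonneg v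

lemma vnorm_nonneg (x : M) (v : TangentSpace 𝓘(ℝ, E) x) : 0 ≤ S.vnorm x v := Real.sqrt_nonneg _

lemma vnorm_sq (x : M) (v : TangentSpace 𝓘(ℝ, E) x) : S.vnorm x v ^ 2 = S.metric x v v :=
  Real.sq_sqrt (S.metric_self_nonneg x v)

lemma vnorm_smul (x : M) {c : ℝ} (hc : 0 ≤ c) (v : TangentSpace 𝓘(ℝ, E) x) :
    S.vnorm x (c • v) = c * S.vnorm x v := by
  rw [vnorm, vnorm, S.metric_smul_left, S.metric_symm, S.metric_smul_left, ← mul_assoc,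
    Real.sqrt_mul (mul_self_nonneg c), Real.sqrt_mul_self hc]

lemma projH_smul (x : M) (c : ℝ) (v : TangentSpace 𝓘(ℝ, E) x) :
    S.projH x (c • v) = c • S.projH x v := by
  simp only [projH, map_smul, smul_sub, smul_smul, smul_eq_mul]

lemma projL_smul (x : M) (c : ℝ) (v : TangentSpace 𝓘(ℝ, E) x) :
    S.projL x (c • v) = c • S.projL x v := by
  simp only [projL, map_smul, smul_smul, smul_eq_mul]

lemma vnorm_projH_le (x : M) (v : TangentSpace 𝓘(ℝ, E) x) :
    S.vnorm x (S.projH x v) ≤ S.vnorm x v := by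
  refine Real.sqrt_le_sqrt ?_
  rw [metric, metric, S.projH_of_mem (S.θ_projH x v), S.θ_projH]
  nlinarith [mul_self_nonneg (S.θ x v)]

lemma vnorm_projL_le (x : M) (v : TangentSpace 𝓘(ℝ, E) x) :
    S.vnorm x (S.projL x v) ≤ S.vnorm x v := by
  refine Real.sqrt_le_sqrt ?_
  have h1 : S.projH x (S.projL x v) = 0 := by simp [projH, projL, θ_reeb]
  have h2 : S.θ x (S.projL x v) = S.θ x v := by simp [projL, θ_reeb]
  have h3 : 0 ≤ S.levi x (S.projH x v) (S.projH x v) := by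
    have := S.metric_self_nonneg x (S.projH x v)
    rw [metric, S.projH_of_mem (S.θ_projH x v), S.θ_projH] at this
    linarith
  rw [metric, metric, h1, h2]
  simpa [levi] using h3

lemma smul_grad_eq {u w : M → ℝ} {x : M} {a b : ℝ}
    (h : ∀ v, a * mvfderiv 𝓘(ℝ, E) u x v = b * mvfderiv 𝓘(ℝ, E) w x v) :
    a • S.grad u x = b • S.grad w x := by
  by_contra hne
  have h1 := S.metric_pos x (sub_ne_zero.2 hne)
  have h2 : ∀ v, S.metric x (a • S.grad u x - b • S.grad w x) v = 0 := fun v => by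
    rw [sub_eq_add_neg, ← neg_smul, S.metric_add_left, S.metric_smul_left, S.metric_smul_left,
      S.metric_grad, S.metric_grad, h]
    ring
  exact h1.ne' (h2 _)

/-- Nondegeneracy of the Webster metric turns the first order condition into an identity between
gradients. Nonnegative factors come out of the norm without absolute values. -/
lemma vnorm_gradH_smul_eq {u w : M → ℝ} {x : M} {a b : ℝ} (ha : 0 ≤ a) (hb : 0 ≤ b)
    (h : ∀ v, a * mvfderiv 𝓘(ℝ, E) u x v = b * mvfderiv 𝓘(ℝ, E) w x v) :
    a * S.vnorm x (S.gradH u x) = b * S.vnorm x (S.gradH w x) := by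
  rw [← S.vnorm_smul x ha, ← S.vnorm_smul x hb, gradH, gradH, ← S.projH_smul, ← S.projH_smul,
    S.smul_grad_eq h]

lemma vnorm_gradL_smul_eq {u w : M → ℝ} {x : M} {a b : ℝ} (ha : 0 ≤ a) (hb : 0 ≤ b)
    (h : ∀ v, a * mvfderiv 𝓘(ℝ, E) u x v = b * mvfderiv 𝓘(ℝ, E) w x v) :
    a * S.vnorm x (S.gradL u x) = b * S.vnorm x (S.gradL w x) := by
  rw [← S.vnorm_smul x ha, ← S.vnorm_smul x hb, gradL, gradL, ← S.projL_smul, ← S.projL_smul,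
    S.smul_grad_eq h]

lemma metric_sum_smul_left (x : M) {ι : Type*} (s : Finset ι) (a : ι → ℝ)
    (e : ι → TangentSpace 𝓘(ℝ, E) x) (w : TangentSpace 𝓘(ℝ, E) x) :
    S.metric x (∑ i ∈ s, a i • e i) w = ∑ i ∈ s, a i * S.metric x (e i) w := by
  have h := congrArg (fun L => L w) (map_sum (S.metricForm x) (fun i => a i • e i) s)
  simp only [LinearMap.sum_apply] at h
  refine h.trans (Finset.sum_congr rfl fun i _ => S.metric_smul_left x _ _ _)

/-- Parseval in `H`: the horizontal frame sees only `∇^H u`. This is how the squared first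
derivatives become `|∇^H u|²` when the second order condition is traced. -/
lemma sum_sq_frame (u : M → ℝ) (x : M) :
    ∑ i, mvfderiv 𝓘(ℝ, E) u x (S.frame x i) ^ 2 = S.vnorm x (S.gradH u x) ^ 2 := by
  have hH : S.θ x (S.gradH u x) = 0 := S.θ_projH x _
  have h1 : ∀ i, S.metric x (S.frame x i) (S.gradH u x)
      = mvfderiv 𝓘(ℝ, E) u x (S.frame x i) := fun i => by
    rw [← S.metric_grad, S.metric_symm, metric, metric, gradH,
      S.projH_of_mem (S.θ_projH x _), S.θ_frame]
    ring
  rw [vnorm_sq]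
  conv_rhs => rw [S.sum_frame hH]
  rw [metric_sum_smul_left]
  refine Finset.sum_congr rfl fun i _ => ?_
  rw [← S.sum_frame hH, h1]
  ring

section LocalMax

variable {u γ : M → ℝ} {x : M} {g g' χ χ' : ℝ → ℝ} {g'' χ'' : ℝ}

/-- The first order condition at a local maximum of `g(u) - χ(γ)`. -/
lemma _root_.IsLocalMax.mvfderiv_eq {a b : ℝ} (hu : ContMDiffAt 𝓘(ℝ, E) 𝓘(ℝ, ℝ) 2 u x)
    (hγ : ContMDiffAt 𝓘(ℝ, E) 𝓘(ℝ, ℝ) 2 γ x)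
    (hg : HasDerivAt g a (u x)) (hχ : HasDerivAt χ b (γ x))
    (hmax : IsLocalMax (fun y => g (u y) - χ (γ y)) x) (v : TangentSpace 𝓘(ℝ, E) x) :
    a * mvfderiv 𝓘(ℝ, E) u x v = b * mvfderiv 𝓘(ℝ, E) γ x v := by
  set e := extChartAt 𝓘(ℝ, E) x with he
  have hx := mem_extChartAt_source (I := 𝓘(ℝ, E)) x
  have hleft : e.symm (e x) = x := extChartAt_to_inv (I := 𝓘(ℝ, E)) x
  have hsymm : ContinuousAt e.symm (e x) := continuousAt_extChartAt_symm (I := 𝓘(ℝ, E)) x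
  have hd : ∀ w : M → ℝ, ContMDiffAt 𝓘(ℝ, E) 𝓘(ℝ, ℝ) 2 w x →
      DifferentiableAt ℝ (w ∘ e.symm) (e x) := fun w hw =>
    ((contMDiffAt_iff.1 hw).2.contDiffAt (by simp)).differentiableAt (by simp)
  rw [mvfderiv_eq_fderiv_chart hx (hd u hu), mvfderiv_eq_fderiv_chart hx (hd γ hγ)]
  have h1 : HasFDerivAt (fun z => g ((u ∘ e.symm) z)) (a • fderiv ℝ (u ∘ e.symm) (e x)) (e x) :=
    HasDerivAt.comp_hasFDerivAt (e x) (by simpa [hleft] using hg) (hd u hu).hasFDerivAt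
  have h2 : HasFDerivAt (fun z => χ ((γ ∘ e.symm) z)) (b • fderiv ℝ (γ ∘ e.symm) (e x)) (e x) :=
    HasDerivAt.comp_hasFDerivAt (e x) (by simpa [hleft] using hχ) (hd γ hγ).hasFDerivAt
  have h3 : IsLocalMax (fun z => g ((u ∘ e.symm) z) - χ ((γ ∘ e.symm) z)) (e x) := by
    have h4 := hsymm.tendsto
    rw [hleft] at h4
    filter_upwards [h4.eventually hmax] with z hz
    simpa [hleft] using hz
  have h5 := congrArg (fun L => L (mfderiv 𝓘(ℝ, E) 𝓘(ℝ, E) e x v))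
    (h3.hasFDerivAt_eq_zero (h1.sub h2))
  exact sub_eq_zero.1 h5

/-- The second order condition at a local maximum of `g(u) - χ(γ)`, in a horizontal direction. -/
lemma hess_le_of_isLocalMax (hu : ContMDiffAt 𝓘(ℝ, E) 𝓘(ℝ, ℝ) 2 u x)
    (hγ : ContMDiffAt 𝓘(ℝ, E) 𝓘(ℝ, ℝ) 2 γ x)
    (hg : ∀ᶠ t in 𝓝 (u x), HasDerivAt g (g' t) t) (hg' : HasDerivAt g' g'' (u x))
    (hχ : ∀ᶠ t in 𝓝 (γ x), HasDerivAt χ (χ' t) t) (hχ' : HasDerivAt χ' χ'' (γ x))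
    (hmax : IsLocalMax (fun y => g (u y) - χ (γ y)) x)
    {v : TangentSpace 𝓘(ℝ, E) x} (hv : S.θ x v = 0) :
    g' (u x) * S.hess u x v v + g'' * mvfderiv 𝓘(ℝ, E) u x v ^ 2
      ≤ χ' (γ x) * S.hess γ x v v + χ'' * mvfderiv 𝓘(ℝ, E) γ x v ^ 2 := by
  obtain ⟨c, hc0, hc, hcw⟩ := S.exists_curve hv
  obtain ⟨u', hu1, hu2, hu3⟩ := hcw u hu
  obtain ⟨γ', hγ1, hγ2, hγ3⟩ := hcw γ hγ
  have h1 : IsLocalMax (fun s => g (u (c s)) - χ (γ (c s))) 0 := by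
    have h := hc.tendsto
    rw [hc0] at h
    filter_upwards [h.eventually hmax] with s hs
    simpa [hc0] using hs
  have e1 : ∀ᶠ s in 𝓝 (0 : ℝ), HasDerivAt g (g' (u (c s))) (u (c s)) := by
    have h := hu1.self_of_nhds.continuousAt.tendsto
    rw [hc0] at h
    exact h.eventually hg
  have e2 : ∀ᶠ s in 𝓝 (0 : ℝ), HasDerivAt χ (χ' (γ (c s))) (γ (c s)) := by
    have h := hγ1.self_of_nhds.continuousAt.tendsto
    rw [hc0] at h
    exact h.eventually hχ
  have h2 : ∀ᶠ s in 𝓝 (0 : ℝ), HasDerivAt (fun s => g (u (c s)) - χ (γ (c s)))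
      (g' (u (c s)) * u' s - χ' (γ (c s)) * γ' s) s := by
    filter_upwards [hu1, hγ1, e1, e2] with s a1 a2 a3 a4
    exact (a3.comp s a1).sub (a4.comp s a2)
  have h3 : HasDerivAt (fun s => g' (u (c s)) * u' s - χ' (γ (c s)) * γ' s) _ 0 :=
    ((HasDerivAt.comp (0 : ℝ) (by rwa [hc0]) hu1.self_of_nhds).mul hu3).sub
      ((HasDerivAt.comp (0 : ℝ) (by rwa [hc0]) hγ1.self_of_nhds).mul hγ3)
  have h4 := h1.second_deriv_nonpos h2 h3
  simp only [Function.comp, hc0, hu2, hγ2] at h4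
  linarith

/-- The second order condition at a local maximum of `g(u) - χ(γ)`, traced over `H`. -/
lemma subLaplacian_le_of_isLocalMax (hu : ContMDiffAt 𝓘(ℝ, E) 𝓘(ℝ, ℝ) 2 u x)
    (hγ : ContMDiffAt 𝓘(ℝ, E) 𝓘(ℝ, ℝ) 2 γ x)
    (hg : ∀ᶠ t in 𝓝 (u x), HasDerivAt g (g' t) t) (hg' : HasDerivAt g' g'' (u x))
    (hχ : ∀ᶠ t in 𝓝 (γ x), HasDerivAt χ (χ' t) t) (hχ' : HasDerivAt χ' χ'' (γ x))
    (hmax : IsLocalMax (fun y => g (u y) - χ (γ y)) x) :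
    g' (u x) * S.subLaplacian u x + g'' * S.vnorm x (S.gradH u x) ^ 2
      ≤ χ' (γ x) * S.subLaplacian γ x + χ'' * S.vnorm x (S.gradH γ x) ^ 2 := by
  rw [← S.sum_sq_frame, ← S.sum_sq_frame, subLaplacian, subLaplacian, Finset.mul_sum,
    Finset.mul_sum, Finset.mul_sum, Finset.mul_sum, ← Finset.sum_add_distrib,
    ← Finset.sum_add_distrib]
  exact Finset.sum_le_sum fun i _ =>
    S.hess_le_of_isLocalMax hu hγ hg hg' hχ hχ' hmax (S.θ_frame x i)

end LocalMax

end PseudoHermitian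
end CR

/-! ### The penalty function -/

lemma MonotoneOn.of_derivWithin_Ici_nonneg {G : ℝ → ℝ} (hG : DifferentiableOn ℝ G (Set.Ici 0))
    (h : ∀ t, 0 ≤ t → 0 ≤ derivWithin G (Set.Ici 0) t) : MonotoneOn G (Set.Ici 0) := by
  refine monotoneOn_of_deriv_nonneg (convex_Ici 0) hG.continuousOn
    (hG.mono interior_subset) fun t ht => ?_
  rw [interior_Ici] at ht
  rw [← derivWithin_of_mem_nhds (Ici_mem_nhds ht)]
  exact h t (le_of_lt ht)

/-- The integral of a nonnegative continuous function that is not integrable at infinity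
diverges. -/
lemma tendsto_integral_atTop_of_not_integrableAtFilter {f : ℝ → ℝ} {r : ℝ}
    (hf : ContinuousOn f (Set.Ici r)) (hf0 : ∀ t, r ≤ t → 0 ≤ f t)
    (hint : ¬ MeasureTheory.IntegrableAtFilter f atTop) :
    Tendsto (fun t => ∫ s in r..t, f s) atTop atTop := by
  have hii : ∀ {a b}, r ≤ a → r ≤ b → IntervalIntegrable f MeasureTheory.volume a b :=
    fun ha hb => (hf.mono fun s hs => le_trans (le_inf ha hb) hs.1).intervalIntegrable
  have hmono : ∀ a b, r ≤ a → a ≤ b → ∫ s in r..a, f s ≤ ∫ s in r..b, f s := by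
    intro a b ha hab
    rw [← intervalIntegral.integral_add_adjacent_intervals (hii le_rfl ha) (hii ha (ha.trans hab))]
    have := intervalIntegral.integral_nonneg (μ := MeasureTheory.volume) hab
      fun s hs => hf0 s (ha.trans hs.1)
    linarith
  rw [tendsto_atTop]
  intro C
  -- The primitive is monotone, so if it does not diverge it is bounded, which forces integrability
  -- at infinity.
  by_contra hC
  apply hint
  have hbd : ∀ t, r ≤ t → ∫ s in r..t, f s ≤ C := by
    intro t ht
    by_contra! hlt
    exact hC ((eventually_ge_atTop t).mono fun s hs => hlt.le.trans (hmono t s ht hs))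
  refine ⟨Set.Ioi r, Ioi_mem_atTop r, ?_⟩
  refine MeasureTheory.integrableOn_Ioi_of_intervalIntegral_norm_bounded C r
    (l := atTop) (b := id) (fun t => ?_) tendsto_id ?_
  · exact ((hf.mono Set.Icc_subset_Ici_self).integrableOn_Icc).mono_set Set.Ioc_subset_Icc_self
  · filter_upwards [eventually_ge_atTop r] with t ht
    refine le_trans (le_of_eq ?_) (hbd t ht)
    refine intervalIntegral.integral_congr fun s hs => ?_
    rw [Set.uIcc_of_le (show r ≤ id t from ht)] at hs
    exact Real.norm_of_nonneg (hf0 s hs.1)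

/-- The penalty function `χ(s) = ∫ G^{-1/2}` from `√R` to `√s`, with its derivatives. -/
lemma exists_penalty {G : ℝ → ℝ} (hG : ContDiffOn ℝ ∞ G (Set.Ici 0)) (hG0 : 0 < G 0)
    (hG' : ∀ t, 0 ≤ t → 0 ≤ derivWithin G (Set.Ici 0) t)
    (hint : ¬ MeasureTheory.IntegrableAtFilter (fun t => G t ^ (-(1 / 2) : ℝ)) atTop)
    {R : ℝ} (hR : 0 < R) :
    ∃ χ χ' χ'' : ℝ → ℝ, ContinuousOn χ (Set.Ici R) ∧ (∀ s, R ≤ s → 0 ≤ χ s) ∧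
      Tendsto χ atTop atTop ∧ ∀ s, R < s → HasDerivAt χ (χ' s) s ∧ HasDerivAt χ' (χ'' s) s ∧
        0 ≤ χ' s ∧ χ'' s ≤ 0 ∧ χ' s * s ^ (1 / 2 : ℝ) ≤ G 0 ^ (-(1 / 2) : ℝ) ∧
        χ' s * (s ^ (1 / 2 : ℝ) * G (s ^ (1 / 2 : ℝ)) ^ (1 / 2 : ℝ)) ≤ 1 := by
  have hGd : DifferentiableOn ℝ G (Set.Ici 0) := hG.differentiableOn (by simp)
  have hmono := MonotoneOn.of_derivWithin_Ici_nonneg hGd hG'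
  have hpos : ∀ t, 0 ≤ t → 0 < G t := fun t ht =>
    hG0.trans_le (hmono (Set.mem_Ici.2 le_rfl) ht ht)
  set q : ℝ → ℝ := fun t => G t ^ (-(1 / 2) : ℝ) with hq
  have hqpos : ∀ t, 0 ≤ t → 0 < q t := fun t ht => Real.rpow_pos_of_pos (hpos t ht) _
  have hqanti : AntitoneOn q (Set.Ici 0) := fun s hs t ht hst =>
    Real.rpow_le_rpow_of_nonpos (hpos s hs) (hmono hs ht hst) (by norm_num)
  have hqc : ContinuousOn q (Set.Ici 0) :=
    hGd.continuousOn.rpow_const fun t ht => Or.inl (hpos t ht).ne'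
  have hqd : ∀ t, 0 < t → DifferentiableAt ℝ q t := fun t ht =>
    ((hGd t ht.le).differentiableAt (Ici_mem_nhds ht)).rpow_const (Or.inl (hpos t ht.le).ne')
  set r := √R with hr
  have hr0 : 0 < r := Real.sqrt_pos.2 hR
  have hΦ : ∀ t, r ≤ t → HasDerivAt (fun t => ∫ s in r..t, q s) (q t) t := fun t ht => by
    have ht0 := hr0.trans_le ht
    refine intervalIntegral.integral_hasDerivAt_right
      ((hqc.mono fun s hs => ?_).intervalIntegrable) ?_ (hqd t ht0).continuousAt
    · rw [Set.uIcc_of_le ht] at hs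
      exact hr0.le.trans hs.1
    · exact (hqc.mono Set.Ioi_subset_Ici_self).stronglyMeasurableAtFilter isOpen_Ioi t ht0
  -- The factor `1/(2√s)` cancels the `√s` in both hypotheses on `γ`: `χ' √s = q(√s)/2` and `χ' √s
  -- G(√s)^{1/2} = 1/2`.
  set χ' : ℝ → ℝ := fun s => q (√s) * (1 / (2 * √s)) with hχ'
  have hd : ∀ s, R ≤ s → HasDerivAt (fun s => ∫ t in r..√s, q t) (χ' s) s := fun s hs =>
    (hΦ (√s) (Real.sqrt_le_sqrt hs)).comp s (Real.hasDerivAt_sqrt (hR.trans_le hs).ne')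
  have hχ'd : ∀ s, 0 < s → DifferentiableAt ℝ χ' s := fun s hs => by
    have h1 : DifferentiableAt ℝ (fun s => √s) s := (Real.hasDerivAt_sqrt hs.ne').differentiableAt
    have h2 : 0 < √s := Real.sqrt_pos.2 hs
    refine ((hqd _ h2).comp s h1).mul ?_
    exact (differentiableAt_const _).div (h1.const_mul 2) (by positivity)
  -- Since `G` is nondecreasing, `χ'` is a product of two positive nonincreasing factors. This is
  -- the source of `χ'' ≤ 0`.
  have hχ'anti : AntitoneOn χ' (Set.Ioi 0) := by
    intro s hs t ht hst
    have h1 : 0 < √s := Real.sqrt_pos.2 hs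
    have h2 : √s ≤ √t := Real.sqrt_le_sqrt hst
    refine mul_le_mul (hqanti h1.le (h1.le.trans h2) h2) ?_ (by positivity) (hqpos _ h1.le).le
    gcongr
  refine ⟨fun s => ∫ t in r..√s, q t, χ', deriv χ',
    fun s hs => (hd s hs).continuousAt.continuousWithinAt, fun s hs => ?_, ?_, fun s hs => ?_⟩
  · exact intervalIntegral.integral_nonneg (Real.sqrt_le_sqrt hs) fun t ht =>
      (hqpos t (hr0.le.trans ht.1)).le
  · exact (tendsto_integral_atTop_of_not_integrableAtFilter
      (hqc.mono (Set.Ici_subset_Ici.2 hr0.le)) (fun t ht => (hqpos t (hr0.le.trans ht)).le)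
      hint).comp Real.tendsto_sqrt_atTop
  · have hs0 : 0 < s := hR.trans hs
    have h2 : 0 < √s := Real.sqrt_pos.2 hs0
    rw [← Real.sqrt_eq_rpow s]
    refine ⟨hd s hs.le, (hχ'd s hs0).hasDerivAt, ?_, ?_, ?_, ?_⟩
    · have := hqpos _ h2.le
      positivity
    · rw [← derivWithin_of_mem_nhds (Ioi_mem_nhds hs0)]
      exact hχ'anti.derivWithin_nonpos
    · have h3 : q (√s) ≤ q 0 := hqanti (Set.mem_Ici.2 le_rfl) h2.le h2.le
      have h4 := hqpos _ h2.le
      have h5 : χ' s * √s = q (√s) / 2 := by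
        simp only [hχ']
        field_simp
      rw [h5]
      simp only [hq] at h3 h4 ⊢
      linarith
    · have h3 := hpos _ h2.le
      have h4 : q (√s) * G (√s) ^ (1 / 2 : ℝ) = 1 := by
        simp only [hq]
        rw [← Real.rpow_add h3]
        norm_num
      have h5 : χ' s * (√s * G (√s) ^ (1 / 2 : ℝ)) = 1 / 2 := by
        calc χ' s * (√s * G (√s) ^ (1 / 2 : ℝ))
            = (q (√s) * G (√s) ^ (1 / 2 : ℝ)) * (√s * (√s)⁻¹) / 2 := by
              simp only [hχ']
              ring
          _ = 1 / 2 := by rw [h4, mul_inv_cancel₀ h2.ne', one_mul]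
      rw [h5]
      norm_num

/-! ### The Omori–Yau maximum principle -/

namespace CR
namespace PseudoHermitian

variable {E : Type*} [NormedAddCommGroup E] [NormedSpace ℝ E]
  {M : Type*} [TopologicalSpace M] [ChartedSpace E M] [IsManifold 𝓘(ℝ, E) ∞ M]
  [FiniteDimensional ℝ E] (S : PseudoHermitian E M)

/-- An Omori-Yau maximum principle for the sub-Laplacian, applied to a composition `g(u)` that is
bounded above. -/
theorem exists_almost_max {γ : M → ℝ} {A B : ℝ} {G : ℝ → ℝ}
    (hγ_smooth : ContMDiff 𝓘(ℝ, E) 𝓘(ℝ, ℝ) 2 γ)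
    (hA : 0 < A) (hB : 0 < B)
    (hγ_proper : Tendsto γ (cocompact M) atTop)
    (hγ_grad : ∀ᶠ x in cocompact M, S.vnorm x (S.grad γ x) ≤ A * γ x ^ (1 / 2 : ℝ))
    (hγ_lap : ∀ᶠ x in cocompact M,
      S.subLaplacian γ x ≤ B * γ x ^ (1 / 2 : ℝ) * G (γ x ^ (1 / 2 : ℝ)) ^ (1 / 2 : ℝ))
    (hG_smooth : ContDiffOn ℝ ∞ G (Set.Ici 0)) (hG_zero : 0 < G 0)
    (hG_mono : ∀ t, 0 ≤ t → 0 ≤ derivWithin G (Set.Ici 0) t)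
    (hG_int : ¬ MeasureTheory.IntegrableAtFilter (fun t => G t ^ (-(1 / 2) : ℝ)) atTop)
    {u : M → ℝ} (hu : ContMDiff 𝓘(ℝ, E) 𝓘(ℝ, ℝ) 2 u) {g g' g'' : ℝ → ℝ} {β C : ℝ}
    (hg : ∀ t, β < t → HasDerivAt g (g' t) t) (hg' : ∀ t, β < t → HasDerivAt g' (g'' t) t)
    (hpos : ∀ t, β < t → 0 < g' t) (hC : ∀ x, β < u x → g (u x) ≤ C)
    {o : M} (ho : β < u o) {δ : ℝ} (hδ : 0 < δ) :
    ∃ x, u o ≤ u x ∧ g' (u x) * S.vnorm x (S.gradH u x) ≤ δ ∧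
      g' (u x) * S.vnorm x (S.gradL u x) ≤ δ ∧
      g' (u x) * S.subLaplacian u x + g'' (u x) * S.vnorm x (S.gradH u x) ^ 2 ≤ δ := by
  have huc := hu.continuous
  have hγc := hγ_smooth.continuous
  have hev : ∀ {x}, β < u x → ∀ᶠ y in 𝓝 x, β < u y := fun h =>
    huc.continuousAt.eventually (lt_mem_nhds h)
  have hgm : StrictMonoOn g (Set.Ioi β) := by
    refine strictMonoOn_of_deriv_pos (convex_Ioi β)
      (fun t ht => (hg t ht).continuousAt.continuousWithinAt) fun t ht => ?_
    rw [interior_Ioi] at ht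
    rw [(hg t ht).deriv]
    exact hpos t ht
  have hge : ∀ {x}, β < u x → ∀ᶠ t in 𝓝 (u x), HasDerivAt g (g' t) t := fun h =>
    (lt_mem_nhds h).mono hg
  -- If `u` attains its maximum, no penalty is needed: the conditions at that point, with `χ = 0`,
  -- already give the bounds.
  by_cases hatt : ∃ k, ∀ y, u y ≤ u k
  · obtain ⟨k, hk⟩ := hatt
    have hβk : β < u k := ho.trans_le (hk o)
    have hmax : IsLocalMax (fun y => g (u y) - (fun _ : ℝ => (0 : ℝ)) (γ y)) k := by
      filter_upwards [hev hβk] with y hy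
      simpa using hgm.monotoneOn hy hβk (hk y)
    have h0 : ∀ t, HasDerivAt (fun _ : ℝ => (0 : ℝ)) ((fun _ : ℝ => (0 : ℝ)) t) t := fun t =>
      hasDerivAt_const t 0
    have hd := hmax.mvfderiv_eq (hu k) (hγ_smooth k) (hg _ hβk) (h0 _)
    have h1 := S.vnorm_gradH_smul_eq (hpos _ hβk).le le_rfl hd
    have h2 := S.vnorm_gradL_smul_eq (hpos _ hβk).le le_rfl hd
    have h3 := S.subLaplacian_le_of_isLocalMax (hu k) (hγ_smooth k) (hge hβk) (hg' _ hβk)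
      (Eventually.of_forall h0) (h0 _) hmax
    refine ⟨k, hk o, ?_, ?_, ?_⟩ <;> linarith
  push Not at hatt
  obtain ⟨R, hR0, hR⟩ : ∃ R, 0 < R ∧ ∀ x, R < γ x →
      S.vnorm x (S.grad γ x) ≤ A * γ x ^ (1 / 2 : ℝ) ∧
      S.subLaplacian γ x ≤ B * γ x ^ (1 / 2 : ℝ) * G (γ x ^ (1 / 2 : ℝ)) ^ (1 / 2 : ℝ) := by
    obtain ⟨K, hK, hKs⟩ := mem_cocompact.1 (hγ_grad.and hγ_lap)
    obtain ⟨R, hR⟩ := (hK.image hγc).bddAbove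
    refine ⟨max R 1, by positivity, fun x hx => hKs fun hxK => ?_⟩
    exact absurd (hR (Set.mem_image_of_mem γ hxK)) (not_le.2 ((le_max_left _ _).trans_lt hx))
  have hcpt : ∀ R, IsCompact {x | γ x ≤ R} := fun R => by
    obtain ⟨K, hK, hKs⟩ := mem_cocompact.1 (hγ_proper.eventually (eventually_gt_atTop R))
    refine hK.of_isClosed_subset (isClosed_le hγc continuous_const) fun x hx => ?_
    by_contra hxK
    exact absurd (show R < γ x from hKs hxK) (not_lt.2 hx)
  obtain ⟨χ, χ', χ'', hχc, hχ0, hχt, hχd⟩ :=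
    exists_penalty hG_smooth hG_zero hG_mono hG_int hR0
  -- Where `γ ≤ R` nothing is known about the derivatives of `γ`. A point with `u` larger than `u k`
  -- lies outside this set, and adjoining `o` ensures `u o ≤ u k`.
  obtain ⟨k, -, hk⟩ := ((hcpt R).union isCompact_singleton).exists_isMaxOn
    ⟨o, Or.inr rfl⟩ huc.continuousOn
  have hko : u o ≤ u k := hk (Or.inr rfl)
  have hβk : β < u k := ho.trans_le hko
  obtain ⟨p, hp⟩ := hatt k
  have hβp : β < u p := hβk.trans hp
  have hRp : R < γ p := by
    by_contra! h
    exact absurd (hk (Or.inl h)) (not_le.2 hp)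
  have hgp : g (u k) < g (u p) := hgm hβk hβp hp
  set c₀ := G 0 ^ (-(1 / 2) : ℝ) with hc₀
  have hc₀pos : 0 < c₀ := Real.rpow_pos_of_pos hG_zero _
  -- The first smallness condition keeps the penalized value at `p` above `g (u k)`. The other two
  -- make the derivatives of the penalty at most `δ`.
  obtain ⟨η, hη, hη1, hη2, hη3⟩ : ∃ η : ℝ, 0 < η ∧ g (u k) < g (u p) - η * χ (γ p) ∧
      η * (A * c₀) ≤ δ ∧ η * B ≤ δ := by
    have t1 : Tendsto (fun η : ℝ => g (u p) - η * χ (γ p)) (𝓝[>] 0) (𝓝 (g (u p))) := by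
      refine tendsto_nhdsWithin_of_tendsto_nhds (Continuous.tendsto' (by fun_prop) _ _ (by simp))
    have t2 : Tendsto (fun η : ℝ => η * (A * c₀)) (𝓝[>] 0) (𝓝 0) := by
      refine tendsto_nhdsWithin_of_tendsto_nhds (Continuous.tendsto' (by fun_prop) _ _ (by simp))
    have t3 : Tendsto (fun η : ℝ => η * B) (𝓝[>] 0) (𝓝 0) := by
      refine tendsto_nhdsWithin_of_tendsto_nhds (Continuous.tendsto' (by fun_prop) _ _ (by simp))
    obtain ⟨η, h1, h2, h3, h4⟩ := (eventually_mem_nhdsWithin.and ((t1.eventually_const_lt hgp).and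
      ((t2.eventually_le_const hδ).and (t3.eventually_le_const hδ)))).exists
    exact ⟨η, h1, h2, h3, h4⟩
  obtain ⟨R', hR'⟩ := eventually_atTop.1
    (hχt.eventually (eventually_gt_atTop ((C - (g (u p) - η * χ (γ p))) / η)))
  set ψ : M → ℝ := fun y => g (u y) - η * χ (γ y) with hψ
  have hfar : ∀ y, R' ≤ γ y → β < u y → ψ y < ψ p := fun y hy hyβ => by
    have h1 := hC y hyβ
    have h2 := hR' _ hy
    rw [div_lt_iff₀ hη] at h2
    simp only [hψ]
    linarith
  -- The constraints `R ≤ γ` and `u k ≤ u` confine the problem to where `χ` and `g` are controlled.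
  -- None of the three can obstruct local maximality: `x` satisfies the last two strictly, and
  -- beyond the first `ψ` is below `ψ p`.
  have hD : IsCompact {y | γ y ≤ max R' (γ p) ∧ R ≤ γ y ∧ u k ≤ u y} :=
    (hcpt _).inter_right ((isClosed_le continuous_const hγc).inter
      (isClosed_le continuous_const huc))
  have hψc : ContinuousOn ψ {y | γ y ≤ max R' (γ p) ∧ R ≤ γ y ∧ u k ≤ u y} := by
    refine ContinuousOn.sub (fun y hy => ?_) (continuousOn_const.mul ?_)
    · exact ((hg _ (hβk.trans_le hy.2.2)).continuousAt.comp huc.continuousAt).continuousWithinAt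
    · exact hχc.comp hγc.continuousOn fun y hy => hy.2.1
  obtain ⟨x, hx, hxmax⟩ := hD.exists_isMaxOn ⟨p, le_max_right _ _, hRp.le, hp.le⟩ hψc
  have hψpx : ψ p ≤ ψ x := hxmax ⟨le_max_right _ _, hRp.le, hp.le⟩
  have hβx : β < u x := hβk.trans_le hx.2.2
  -- Equality would give `ψ x ≤ g (u k) < ψ p`, because `χ ≥ 0`. Strictness then yields `R < γ x` by
  -- the choice of `k`.
  have hux : u k < u x := by
    refine lt_of_le_of_ne hx.2.2 fun h => ?_
    have h1 : 0 ≤ η * χ (γ x) := mul_nonneg hη.le (hχ0 _ hx.2.1)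
    simp only [hψ, ← h] at hψpx
    linarith
  have hRx : R < γ x := by
    by_contra! h
    exact absurd (hk (Or.inl h)) (not_le.2 hux)
  have hmax : IsLocalMax (fun y => g (u y) - (fun s => η * χ s) (γ y)) x := by
    filter_upwards [hγc.continuousAt.eventually (lt_mem_nhds hRx),
      huc.continuousAt.eventually (lt_mem_nhds hux)] with y hy1 hy2
    by_cases hy : γ y ≤ max R' (γ p)
    · exact hxmax ⟨hy, hy1.le, hy2.le⟩
    · exact (hfar y ((le_max_left _ _).trans (not_le.1 hy).le) (hβk.trans hy2)).le.trans hψpx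
  obtain ⟨a1, a2, a3, a4, a5, a6⟩ := hχd _ hRx
  have hχe : ∀ᶠ s in 𝓝 (γ x), HasDerivAt (fun s => η * χ s) ((fun s => η * χ' s) s) s :=
    (lt_mem_nhds hRx).mono fun s hs => (hχd s hs).1.const_mul η
  have hd := hmax.mvfderiv_eq (hu x) (hγ_smooth x) (hg _ hβx) (a1.const_mul η)
  have hnn : 0 ≤ η * χ' (γ x) := mul_nonneg hη.le a3
  have h1 := S.vnorm_gradH_smul_eq (hpos _ hβx).le hnn hd
  have h2 := S.vnorm_gradL_smul_eq (hpos _ hβx).le hnn hd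
  have h3 := S.subLaplacian_le_of_isLocalMax (hu x) (hγ_smooth x) (hge hβx) (hg' _ hβx)
    hχe (a2.const_mul η) hmax
  obtain ⟨b1, b2⟩ := hR x hRx
  have hgr : η * χ' (γ x) * S.vnorm x (S.grad γ x) ≤ δ := by
    calc η * χ' (γ x) * S.vnorm x (S.grad γ x)
        ≤ η * χ' (γ x) * (A * γ x ^ (1 / 2 : ℝ)) := by gcongr
      _ = η * A * (χ' (γ x) * γ x ^ (1 / 2 : ℝ)) := by ring
      _ ≤ η * A * c₀ := by gcongr
      _ ≤ δ := by linarith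
  refine ⟨x, hko.trans hux.le, ?_, ?_, h3.trans ?_⟩
  · rw [h1]
    exact (mul_le_mul_of_nonneg_left (S.vnorm_projH_le x _) hnn).trans hgr
  · rw [h2]
    exact (mul_le_mul_of_nonneg_left (S.vnorm_projL_le x _) hnn).trans hgr
  -- Only an upper bound on the right-hand side is needed, so concavity of `χ` lets the gradient
  -- term be dropped.
  · have c1 : η * χ'' (γ x) * S.vnorm x (S.gradH γ x) ^ 2 ≤ 0 :=
      mul_nonpos_of_nonpos_of_nonneg (mul_nonpos_of_nonneg_of_nonpos hη.le a4) (sq_nonneg _)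
    have c2 : η * χ' (γ x) * S.subLaplacian γ x ≤ δ := by
      calc η * χ' (γ x) * S.subLaplacian γ x
          ≤ η * χ' (γ x) * (B * γ x ^ (1 / 2 : ℝ) * G (γ x ^ (1 / 2 : ℝ)) ^ (1 / 2 : ℝ)) := by
            gcongr
        _ = η * B * (χ' (γ x) * (γ x ^ (1 / 2 : ℝ) * G (γ x ^ (1 / 2 : ℝ)) ^ (1 / 2 : ℝ))) := by
            ring
        _ ≤ η * B * 1 := by gcongr
        _ ≤ δ := by linarith
    linarith

end PseudoHermitian
end CR

/-! ### Convexity on the closed quadrant -/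

/-- A `C²` function with nonnegative Hessian on a convex set is convex, including at the boundary
of the set. -/
lemma ConvexOn.of_iteratedFDerivWithin_two_nonneg {V : Type*} [NormedAddCommGroup V]
    [NormedSpace ℝ V] {K : Set V} {Φ : V → ℝ} (hK : Convex ℝ K) (hKu : UniqueDiffOn ℝ K)
    (hΦ : ContDiffOn ℝ 2 Φ K)
    (h : ∀ p ∈ K, ∀ v, 0 ≤ iteratedFDerivWithin ℝ 2 Φ K p ![v, v]) : ConvexOn ℝ K Φ := by
  refine ⟨hK, fun p hp q hq a b ha hb hab => ?_⟩
  -- Restriction to segments reduces to one variable. Derivatives within `K` are used throughout, so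
  -- segments in the boundary are covered.
  set l : ℝ → V := fun s => p + s • (q - p) with hl
  have hlK : Set.MapsTo l (Set.Icc 0 1) K := fun s hs =>
    hK.add_smul_sub_mem hp hq hs
  have hld : ∀ s, HasDerivAt l (q - p) s := fun s =>
    (((hasDerivAt_id s).smul_const (q - p)).const_add p).congr_deriv (one_smul _ _)
  have hint : interior (Set.Icc (0 : ℝ) 1) ⊆ Set.Icc 0 1 := interior_subset
  have hd1 : ∀ y ∈ K, HasFDerivWithinAt Φ (fderivWithin ℝ Φ K y) K y := fun y hy =>
    (hΦ.differentiableOn (by simp) y hy).hasFDerivWithinAt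
  have hd2 : ∀ y ∈ K, HasFDerivWithinAt (fderivWithin ℝ Φ K)
      (fderivWithin ℝ (fderivWithin ℝ Φ K) K y) K y := fun y hy =>
    ((hΦ.fderivWithin hKu (m := 1) (by norm_num)).differentiableOn (by simp) y hy).hasFDerivWithinAt
  have hconv : ConvexOn ℝ (Set.Icc (0 : ℝ) 1) (fun s => Φ (l s)) := by
    refine convexOn_of_hasDerivWithinAt2_nonneg (convex_Icc 0 1)
      (f' := fun s => fderivWithin ℝ Φ K (l s) (q - p))
      (f'' := fun s => fderivWithin ℝ (fderivWithin ℝ Φ K) K (l s) (q - p) (q - p))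
      (hΦ.continuousOn.comp (fun s _ => (hld s).continuousAt.continuousWithinAt) hlK) ?_ ?_ ?_
    · intro s hs
      exact (hd1 _ (hlK (hint hs))).comp_hasDerivWithinAt s (hld s).hasDerivWithinAt
        (hlK.mono_left hint)
    · intro s hs
      have h1 := (hd2 _ (hlK (hint hs))).comp_hasDerivWithinAt s (hld s).hasDerivWithinAt
        (hlK.mono_left hint)
      simpa using! h1.clm_apply (hasDerivWithinAt_const s _ (q - p))
    · intro s hs
      have h1 := h _ (hlK (hint hs)) (q - p)
      rwa [iteratedFDerivWithin_two_apply Φ hKu (hlK (hint hs))] at h1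
  have h1 := hconv.2 (x := 0) (by simp) (y := 1) (by simp) ha hb hab
  have h2 : l (a • (0 : ℝ) + b • (1 : ℝ)) = a • p + b • q := by
    obtain rfl : a = 1 - b := by linarith
    simp only [hl, smul_eq_mul, mul_zero, mul_one, zero_add]
    module
  simp only [h2] at h1
  simpa [hl] using h1

/-- A convex function lies above its linearization, also at a boundary point. -/
lemma ConvexOn.add_le_of_hasFDerivWithinAt {V : Type*} [NormedAddCommGroup V]
    [NormedSpace ℝ V] {K : Set V} {Φ : V → ℝ} (hΦ : ConvexOn ℝ K Φ) {p q : V} (hp : p ∈ K)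
    (hq : q ∈ K) {L : V →L[ℝ] ℝ} (hL : HasFDerivWithinAt Φ L K p) :
    Φ p + L (q - p) ≤ Φ q := by
  have hmaps : Set.MapsTo (fun s : ℝ => p + s • (q - p)) (Set.Icc 0 1) K := fun s hs =>
    hΦ.1.add_smul_sub_mem hp hq hs
  have hconv : ConvexOn ℝ (Set.Icc (0 : ℝ) 1) (fun s : ℝ => Φ (p + s • (q - p))) := by
    refine ⟨convex_Icc 0 1, fun s hs t ht a b ha hb hab => ?_⟩
    have h1 := hΦ.2 (hmaps hs) (hmaps ht) ha hb hab
    have h2 : a • (p + s • (q - p)) + b • (p + t • (q - p))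
        = p + (a • s + b • t) • (q - p) := by
      rw [← eq_sub_iff_add_eq] at hab
      subst hab
      simp only [smul_eq_mul]
      module
    rwa [h2] at h1
  have hld : HasDerivAt (fun s : ℝ => p + s • (q - p)) (q - p) 0 :=
    (((hasDerivAt_id (0 : ℝ)).smul_const (q - p)).const_add p).congr_deriv (one_smul _ _)
  have hL' : HasFDerivWithinAt Φ L K ((fun s : ℝ => p + s • (q - p)) 0) := by simpa using hL
  have hd := hL'.comp_hasDerivWithinAt 0 hld.hasDerivWithinAt hmaps
  have h3 := hconv.le_slope_of_hasDerivWithinAt (by simp) (by simp) one_pos hd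
  simp [slope_def_field] at h3
  rw [map_sub]
  linarith

lemma uniqueDiffOn_quadrant : UniqueDiffOn ℝ (Set.Ici (0 : ℝ × ℝ)) := by
  rw [Set.Ici_prod_eq]
  exact (uniqueDiffOn_Ici _).prod (uniqueDiffOn_Ici _)

/-- The tangent plane at the corner supports the graph, and its slopes are the one-sided partial
derivatives appearing in the growth hypotheses. -/
lemma add_derivWithin_le_of_convexOn {Φ : ℝ → ℝ → ℝ}
    (hΦ : ConvexOn ℝ (Set.Ici (0 : ℝ × ℝ)) fun p : ℝ × ℝ => Φ p.1 p.2)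
    (hd : DifferentiableWithinAt ℝ (fun p : ℝ × ℝ => Φ p.1 p.2) (Set.Ici 0) 0)
    {y z : ℝ} (hy : 0 ≤ y) (hz : 0 ≤ z) :
    Φ 0 0 + derivWithin (fun y => Φ y 0) (Set.Ici 0) 0 * y
      + derivWithin (fun z => Φ 0 z) (Set.Ici 0) 0 * z ≤ Φ y z := by
  obtain ⟨L, hL⟩ := hd
  have h1 := hΦ.add_le_of_hasFDerivWithinAt (Set.mem_Ici.2 le_rfl)
    (show (y, z) ∈ Set.Ici (0 : ℝ × ℝ) from ⟨hy, hz⟩) hL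
  have e1 : derivWithin (fun y => Φ y 0) (Set.Ici 0) 0 = L (1, 0) := by
    have h2 : HasDerivWithinAt (fun s : ℝ => (s, (0 : ℝ))) (1, 0) (Set.Ici 0) 0 :=
      (hasDerivWithinAt_id _ _).prodMk (hasDerivWithinAt_const _ _ _)
    exact (HasFDerivWithinAt.comp_hasDerivWithinAt (0 : ℝ) (f := fun s : ℝ => (s, (0 : ℝ)))
      hL h2 fun s hs => ⟨hs, le_rfl⟩).derivWithin (uniqueDiffWithinAt_Ici 0)
  have e2 : derivWithin (fun z => Φ 0 z) (Set.Ici 0) 0 = L (0, 1) := by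
    have h2 : HasDerivWithinAt (fun s : ℝ => ((0 : ℝ), s)) (0, 1) (Set.Ici 0) 0 :=
      (hasDerivWithinAt_const _ _ _).prodMk (hasDerivWithinAt_id _ _)
    exact (HasFDerivWithinAt.comp_hasDerivWithinAt (0 : ℝ) (f := fun s : ℝ => ((0 : ℝ), s))
      hL h2 fun s hs => ⟨le_rfl, hs⟩).derivWithin (uniqueDiffWithinAt_Ici 0)
  have e3 : ((y, z) : ℝ × ℝ) - 0 = y • (1, 0) + z • (0, 1) := by simp
  rw [e3, map_add, map_smul, map_smul, ← e1, ← e2] at h1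
  simp only [smul_eq_mul, Prod.fst_zero, Prod.snd_zero] at h1
  linarith

/-- A lower bound of a convex function on `[0, h]²` in terms of five values away from the
axes. -/
lemma lt_of_convexOn_quadrant {Φ : ℝ → ℝ → ℝ} {m h : ℝ}
    (hΦ : ConvexOn ℝ (Set.Ici (0 : ℝ × ℝ)) fun p : ℝ × ℝ => Φ p.1 p.2) (hh : 0 < h)
    (h11 : m < 2 * Φ h h - Φ h h) (h12 : m < 2 * Φ h h - Φ h (2 * h))
    (h21 : m < 2 * Φ h h - Φ (2 * h) h) (h22 : m < 2 * Φ h h - Φ (2 * h) (2 * h))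
    {y z : ℝ} (hy : 0 ≤ y) (hz : 0 ≤ z) (hyh : y ≤ h) (hzh : z ≤ h) : m < Φ y z := by
  have key : ∀ r s, 0 ≤ r → 0 ≤ s → ((r, s) : ℝ × ℝ) ∈ Set.Ici (0 : ℝ × ℝ) :=
    fun r s hr hs => ⟨hr, hs⟩
  have hv : ∀ r s, h ≤ r → r ≤ 2 * h → 0 ≤ s → Φ r s ≤ max (Φ h s) (Φ (2 * h) s) := by
    intro r s hr hr' hs
    refine hΦ.le_max_of_mem_segment (x := (h, s)) (y := (2 * h, s)) (z := (r, s))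
      (key _ _ hh.le hs) (key _ _ (by linarith) hs) ?_
    rw [← Prod.image_mk_segment_left, segment_eq_Icc (by linarith)]
    exact ⟨r, ⟨hr, hr'⟩, rfl⟩
  have hw : ∀ r s, h ≤ s → s ≤ 2 * h → 0 ≤ r → Φ r s ≤ max (Φ r h) (Φ r (2 * h)) := by
    intro r s hs hs' hr
    refine hΦ.le_max_of_mem_segment (x := (r, h)) (y := (r, 2 * h)) (z := (r, s))
      (key _ _ hr hh.le) (key _ _ hr (by linarith)) ?_
    rw [← Prod.image_mk_segment_right, segment_eq_Icc (by linarith)]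
    exact ⟨s, ⟨hs, hs'⟩, rfl⟩
  -- Reflect `(y, z)` in `(h, h)`. The image lies in `[h, 2h]²`, where a convex function is bounded
  -- by its values at the vertices. The midpoint inequality at `(h, h)` then bounds `Φ y z` from
  -- below.
  have h1 : Φ (2 * h - y) (2 * h - z) < 2 * Φ h h - m := by
    refine (hv _ _ (by linarith) (by linarith) (by linarith)).trans_lt (max_lt ?_ ?_)
    · exact (hw _ _ (by linarith) (by linarith) hh.le).trans_lt
        (max_lt (by linarith) (by linarith))
    · exact (hw _ _ (by linarith) (by linarith) (by linarith)).trans_lt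
        (max_lt (by linarith) (by linarith))
  have h2 := hΦ.2 (key y z hy hz) (key (2 * h - y) (2 * h - z) (by linarith) (by linarith))
    (by norm_num : (0 : ℝ) ≤ 1 / 2) (by norm_num : (0 : ℝ) ≤ 1 / 2) (by norm_num)
  have e1 : (1 / 2 : ℝ) * y + 1 / 2 * (2 * h - y) = h := by ring
  have e2 : (1 / 2 : ℝ) * z + 1 / 2 * (2 * h - z) = h := by ring
  simp only [Prod.fst_add, Prod.snd_add, Prod.smul_fst, Prod.smul_snd, smul_eq_mul, e1, e2] at h2
  linarith

/-- Lower semicontinuity at the corner, for a function that is continuous in the parameter `t`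
and convex in the other variables. -/
lemma exists_pos_lt_of_pos_corner {φ : ℝ → ℝ → ℝ → ℝ}
    (hφ_cont : ∀ x₁ x₂, 0 ≤ x₁ → 0 ≤ x₂ → Continuous fun t => φ t x₁ x₂)
    (hconv : ∀ t, ConvexOn ℝ (Set.Ici (0 : ℝ × ℝ)) fun p : ℝ × ℝ => φ t p.1 p.2)
    {t₀ : ℝ} (hc : ContinuousOn (fun p : ℝ × ℝ => φ t₀ p.1 p.2) (Set.Ici 0))
    (h0 : 0 < φ t₀ 0 0) :
    ∃ h > 0, ∃ m > 0, ∀ᶠ t in 𝓝 t₀, ∀ y z, 0 ≤ y → 0 ≤ z → y ≤ h → z ≤ h → m < φ t y z := by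
  have hlim : ∀ a b : ℝ, 0 ≤ a → 0 ≤ b →
      Tendsto (fun h : ℝ => φ t₀ (a * h) (b * h)) (𝓝[>] 0) (𝓝 (φ t₀ 0 0)) := by
    intro a b ha hb
    refine Tendsto.comp (hc 0 (Set.mem_Ici.2 le_rfl))
      (f := fun h : ℝ => (a * h, b * h)) (tendsto_nhdsWithin_iff.2 ⟨?_, ?_⟩)
    · exact tendsto_nhdsWithin_of_tendsto_nhds
        (Continuous.tendsto' (by fun_prop) _ _ (by simp))
    · filter_upwards [self_mem_nhdsWithin] with h hh
      exact ⟨mul_nonneg ha (le_of_lt hh), mul_nonneg hb (le_of_lt hh)⟩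
  -- Continuity in `t` is only assumed pointwise in `(x₁, x₂)`, so it can be used at finitely many
  -- points only. The vertices of `[h, 2h]²` suffice, and for small `h` each of these differences is
  -- close to `φ t₀ 0 0`.
  have hev : ∀ a b : ℝ, 0 ≤ a → 0 ≤ b → ∀ᶠ h in 𝓝[>] (0 : ℝ),
      φ t₀ 0 0 / 2 < 2 * φ t₀ h h - φ t₀ (a * h) (b * h) := by
    intro a b ha hb
    have h1 := hlim 1 1 zero_le_one zero_le_one
    simp only [one_mul] at h1
    exact ((h1.const_mul 2).sub (hlim a b ha hb)).eventually_const_lt (by linarith)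
  obtain ⟨h, hh, h1, h2, h3, h4⟩ := (eventually_mem_nhdsWithin.and
    ((hev 1 1 zero_le_one zero_le_one).and ((hev 1 2 zero_le_one zero_le_two).and
      ((hev 2 1 zero_le_two zero_le_one).and (hev 2 2 zero_le_two zero_le_two))))).exists
  have hh' : (0 : ℝ) < h := hh
  simp only [one_mul] at h1 h2 h3
  have hct : ∀ r s, 0 ≤ r → 0 ≤ s → φ t₀ 0 0 / 2 < 2 * φ t₀ h h - φ t₀ r s →
      ∀ᶠ t in 𝓝 t₀, φ t₀ 0 0 / 2 < 2 * φ t h h - φ t r s := fun r s hr hs hlt =>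
    (((hφ_cont h h hh'.le hh'.le).const_mul 2).sub (hφ_cont r s hr hs)).continuousAt.eventually
      (lt_mem_nhds hlt)
  refine ⟨h, hh', φ t₀ 0 0 / 2, by positivity, ?_⟩
  filter_upwards [hct h h hh'.le hh'.le h1, hct h (2 * h) hh'.le (by positivity) h2,
    hct (2 * h) h (by positivity) hh'.le h3, hct (2 * h) (2 * h) (by positivity) (by positivity) h4]
    with t a1 a2 a3 a4 y z hy hz hyh hzh
  exact lt_of_convexOn_quadrant (hconv t) hh' a1 a2 a3 a4 hy hz hyh hzh

/-! ### Eventual bounds from the liminf and limsup hypotheses -/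

lemma exists_pos_eventually_of_pos_liminf {q : ℝ → ℝ}
    (h : 0 < liminf (fun t : ℝ => ((q t : ℝ) : EReal)) atTop) :
    ∃ c > 0, ∀ᶠ t in atTop, c < q t := by
  obtain ⟨c, hc0, hc⟩ := EReal.lt_iff_exists_real_btwn.1 h
  exact ⟨c, by exact_mod_cast hc0,
    (eventually_lt_of_lt_liminf hc).mono fun t ht => by exact_mod_cast ht⟩

lemma eventually_gt_of_bot_lt_liminf {q : ℝ → ℝ}
    (h : ⊥ < liminf (fun t : ℝ => ((q t : ℝ) : EReal)) atTop) :
    ∃ c > 0, ∀ᶠ t in atTop, -c < q t := by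
  obtain ⟨c, -, hc⟩ := EReal.lt_iff_exists_real_btwn.1 h
  refine ⟨|c| + 1, by positivity, (eventually_lt_of_lt_liminf hc).mono fun t ht => ?_⟩
  have : c < q t := by exact_mod_cast ht
  linarith [neg_abs_le c]

lemma eventually_lt_of_limsup_lt_top {q : ℝ → ℝ}
    (h : limsup (fun t : ℝ => ((q t : ℝ) : EReal)) atTop < ⊤) :
    ∃ c > 0, ∀ᶠ t in atTop, q t < c := by
  obtain ⟨c, hc, -⟩ := EReal.lt_iff_exists_real_btwn.1 h
  refine ⟨|c| + 1, by positivity, (eventually_lt_of_limsup_lt hc).mono fun t ht => ?_⟩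
  have : q t < c := by exact_mod_cast ht
  linarith [le_abs_self c]

/-! ### The Keller–Osserman function -/

section KellerOsserman

variable {F : ℝ → ℝ} {a : ℝ}

lemma integral_pos_of_gt (hF_cont : ContinuousOn F (Set.Ici a)) (hF_pos : ∀ t, a ≤ t → 0 < F t)
    {t : ℝ} (ht : a < t) : 0 < ∫ s in a..t, F s := by
  refine intervalIntegral.intervalIntegral_pos_of_pos_on ?_ (fun s hs => hF_pos s hs.1.le) ht
  refine (hF_cont.mono fun s hs => ?_).intervalIntegrable
  rw [Set.uIcc_of_le ht.le] at hs
  exact hs.1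

lemma hasDerivAt_integral_of_gt (hF_cont : ContinuousOn F (Set.Ici a)) {t : ℝ} (ht : a < t) :
    HasDerivAt (fun t => ∫ s in a..t, F s) (F t) t := by
  refine intervalIntegral.integral_hasDerivAt_right ?_ ?_ (hF_cont.continuousAt (Ici_mem_nhds ht))
  · refine (hF_cont.mono fun s hs => ?_).intervalIntegrable
    rw [Set.uIcc_of_le ht.le] at hs
    exact hs.1
  · exact (hF_cont.mono Set.Ioi_subset_Ici_self).stronglyMeasurableAtFilter isOpen_Ioi t ht

lemma rpow_neg_half_cube {y : ℝ} (hy : 0 < y) :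
    y ^ (-(1 / 2) - 1 : ℝ) = (y ^ (-(1 / 2) : ℝ)) ^ 3 := by
  rw [← Real.rpow_natCast, ← Real.rpow_mul hy.le]
  norm_num

/-- Writing the derivative through the cube of `p = P^{-1/2}`, where `P = ∫ F`, makes `g'' |∇^H u|²`
equal to `-(F p)(p |∇^H u|)²/2`, a multiple of the same factor `F p` as the main term. -/
lemma hasDerivAt_integral_rpow (hF_cont : ContinuousOn F (Set.Ici a))
    (hF_pos : ∀ t, a ≤ t → 0 < F t) {t : ℝ} (ht : a < t) :
    HasDerivAt (fun t => (∫ s in a..t, F s) ^ (-(1 / 2) : ℝ))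
      (-(1 / 2) * F t * ((∫ s in a..t, F s) ^ (-(1 / 2) : ℝ)) ^ 3) t := by
  have hP := integral_pos_of_gt hF_cont hF_pos ht
  refine ((hasDerivAt_integral_of_gt hF_cont ht).rpow_const (Or.inl hP.ne')).congr_deriv ?_
  rw [rpow_neg_half_cube hP]
  ring

lemma antitoneOn_integral_rpow (hF_cont : ContinuousOn F (Set.Ici a))
    (hF_pos : ∀ t, a ≤ t → 0 < F t) :
    AntitoneOn (fun t => (∫ s in a..t, F s) ^ (-(1 / 2) : ℝ)) (Set.Ioi a) := by
  refine antitoneOn_of_deriv_nonpos (convex_Ioi a)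
    (fun t ht => (hasDerivAt_integral_rpow hF_cont hF_pos ht).continuousAt.continuousWithinAt)
    (fun t ht => ?_) fun t ht => ?_
  · rw [interior_Ioi] at ht
    exact (hasDerivAt_integral_rpow hF_cont hF_pos ht).differentiableAt.differentiableWithinAt
  · rw [interior_Ioi] at ht
    rw [(hasDerivAt_integral_rpow hF_cont hF_pos ht).deriv]
    have h1 := hF_pos t (le_of_lt ht)
    have h2 : 0 < (∫ s in a..t, F s) ^ (-(1 / 2) : ℝ) :=
      Real.rpow_pos_of_pos (integral_pos_of_gt hF_cont hF_pos ht) _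
    have : 0 < F t * ((∫ s in a..t, F s) ^ (-(1 / 2) : ℝ)) ^ 3 := by positivity
    linarith

variable {b : ℝ}

lemma integral_rpow_le (hF_cont : ContinuousOn F (Set.Ici a))
    (hF_pos : ∀ t, a ≤ t → 0 < F t) (hb : a < b)
    (hint : MeasureTheory.IntegrableOn
      (fun t => (∫ s in a..t, F s) ^ (-(1 / 2) : ℝ)) (Set.Ioi b)) {t : ℝ} (ht : b ≤ t) :
    ∫ r in b..t, (∫ s in a..r, F s) ^ (-(1 / 2) : ℝ)
      ≤ ∫ r in Set.Ioi b, (∫ s in a..r, F s) ^ (-(1 / 2) : ℝ) := by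
  rw [intervalIntegral.integral_of_le ht]
  refine MeasureTheory.setIntegral_mono_set hint ?_ Set.Ioc_subset_Ioi_self.eventuallyLE
  filter_upwards [MeasureTheory.ae_restrict_mem measurableSet_Ioi] with r hr
  exact (Real.rpow_pos_of_pos (integral_pos_of_gt hF_cont hF_pos (hb.trans hr)) _).le

lemma hasDerivAt_integral_integral_rpow (hF_cont : ContinuousOn F (Set.Ici a))
    (hF_pos : ∀ t, a ≤ t → 0 < F t) (hb : a < b) {t : ℝ} (ht : b ≤ t) :
    HasDerivAt (fun t => ∫ r in b..t, (∫ s in a..r, F s) ^ (-(1 / 2) : ℝ))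
      ((∫ s in a..t, F s) ^ (-(1 / 2) : ℝ)) t := by
  have hc : ContinuousOn (fun t => (∫ s in a..t, F s) ^ (-(1 / 2) : ℝ)) (Set.Ioi a) :=
    fun r hr => (hasDerivAt_integral_rpow hF_cont hF_pos hr).continuousAt.continuousWithinAt
  have hat := hb.trans_le ht
  refine intervalIntegral.integral_hasDerivAt_right ?_
    (hc.stronglyMeasurableAtFilter isOpen_Ioi t hat) (hc.continuousAt (Ioi_mem_nhds hat))
  refine (hc.mono fun s hs => ?_).intervalIntegrable
  rw [Set.uIcc_of_le ht] at hs
  exact hb.trans_le hs.1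

/-- The two growth conditions on `F` bound `F / √(∫ F)` from below. -/
lemma exists_pos_le_mul_integral_rpow (hF_cont : ContinuousOn F (Set.Ici a))
    (hF_pos : ∀ t, a ≤ t → 0 < F t) (hb : a < b)
    (hint : MeasureTheory.IntegrableOn
      (fun t => (∫ s in a..t, F s) ^ (-(1 / 2) : ℝ)) (Set.Ioi b))
    {C : ℝ} (hC : 0 < C) (hgrowth : ∀ᶠ t in atTop, (∫ s in a..t, F s) / (t * F t) < C) :
    ∃ κ > 0, ∀ᶠ t in atTop, κ ≤ F t * (∫ s in a..t, F s) ^ (-(1 / 2) : ℝ) := by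
  set p : ℝ → ℝ := fun t => (∫ s in a..t, F s) ^ (-(1 / 2) : ℝ) with hp
  set I := (∫ r in Set.Ioi b, p r) with hI
  have hanti := antitoneOn_integral_rpow hF_cont hF_pos
  -- Monotonicity and integrability of `p` together force decay at least like `1/t`.
  have hbound : ∀ t, b ≤ t → (t - b) * p t ≤ I := by
    intro t ht
    have h1 : ∫ r in b..t, p t ≤ ∫ r in b..t, p r := by
      refine intervalIntegral.integral_mono_on ht intervalIntegrable_const ?_ fun r hr =>
        hanti (hb.trans_le hr.1) (hb.trans_le ht) hr.2
      refine AntitoneOn.intervalIntegrable (hanti.mono fun s hs => ?_)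
      rw [Set.uIcc_of_le ht] at hs
      exact hb.trans_le hs.1
    rw [intervalIntegral.integral_const, smul_eq_mul] at h1
    exact h1.trans (integral_rpow_le hF_cont hF_pos hb hint ht)
  have hI0 : 0 ≤ I := by simpa using hbound b le_rfl
  -- From `p² ∫ F = 1` and `∫ F < C t F` one gets `1 ≤ (F p) C (t p)`. For `t > 2b`, `t < 2(t - b)`
  -- gives `t p ≤ 2(I + 1)`. The `+ 1` keeps the denominator positive.
  refine ⟨1 / (2 * C * (I + 1)), by positivity, ?_⟩
  filter_upwards [hgrowth, eventually_gt_atTop (max (2 * b) 0), eventually_gt_atTop b]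
    with t h1 h2 h3
  have hat := hb.trans h3
  have ht0 : 0 < t := (le_max_right _ _).trans_lt h2
  have htb : 2 * b < t := (le_max_left _ _).trans_lt h2
  have hF := hF_pos t hat.le
  have hP := integral_pos_of_gt hF_cont hF_pos hat
  have hpt : 0 < p t := Real.rpow_pos_of_pos hP _
  have hsq : p t * p t * (∫ s in a..t, F s) = 1 := by
    simp only [hp]
    rw [← Real.rpow_add hP, ← Real.rpow_add_one hP.ne']
    norm_num
  have h5 := hbound t h3.le
  rw [div_lt_iff₀ (by positivity)] at h1
  have h6 : t * p t ≤ 2 * (I + 1) := by nlinarith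
  have h7 : 1 ≤ (F t * p t) * (C * (t * p t)) := by
    have := mul_le_mul_of_nonneg_left h1.le (mul_nonneg hpt.le hpt.le)
    rw [hsq] at this
    linarith
  have h8 : (F t * p t) * (C * (t * p t)) ≤ (F t * p t) * (C * (2 * (I + 1))) := by gcongr
  rw [div_le_iff₀ (by positivity)]
  linarith

end KellerOsserman

/-! ### The main theorem -/

theorem theorem5p1 (m : ℕ)
    (M : Type*) [TopologicalSpace M] [T2Space M] [SecondCountableTopology M] [Nonempty M]
    [ChartedSpace (EuclideanSpace ℝ (Fin (2 * m + 1))) M]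
    [IsManifold 𝓘(ℝ, EuclideanSpace ℝ (Fin (2 * m + 1))) ∞ M]
    -- the pseudo-Hermitian manifold `(M^{2m+1}, H, J, θ)`
    (S : CR.PseudoHermitian (EuclideanSpace ℝ (Fin (2 * m + 1))) M)
    -- the exhaustion function `γ` and the function `G`
    (γ : M → ℝ) (A B : ℝ) (G : ℝ → ℝ)
    (hγ_smooth : ContMDiff 𝓘(ℝ, EuclideanSpace ℝ (Fin (2 * m + 1))) 𝓘(ℝ, ℝ) 2 γ)
    (hγ_nonneg : ∀ x, 0 ≤ γ x)
    (hA : 0 < A) (hB : 0 < B)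
    (hγ_proper : Tendsto γ (cocompact M) atTop)
    (hγ_grad : ∀ᶠ x in cocompact M, S.vnorm x (S.grad γ x) ≤ A * γ x ^ (1 / 2 : ℝ))
    (hγ_lap : ∀ᶠ x in cocompact M,
      S.subLaplacian γ x ≤ B * γ x ^ (1 / 2 : ℝ) * G (γ x ^ (1 / 2 : ℝ)) ^ (1 / 2 : ℝ))
    (hG_smooth : ContDiffOn ℝ ∞ G (Set.Ici 0))
    (hG_zero : 0 < G 0)
    (hG_mono : ∀ t, 0 ≤ t → 0 ≤ derivWithin G (Set.Ici 0) t)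
    (hG_int : ¬ MeasureTheory.IntegrableAtFilter (fun t => G t ^ (-(1 / 2) : ℝ)) atTop)
    (hG_growth : limsup (fun t : ℝ => ((t * G (t ^ (1 / 2 : ℝ)) / G t : ℝ) : EReal)) atTop < ⊤)
    -- the function `u` and the nonlinearity `φ(t, x₁, x₂)`, for `x₁, x₂ ≥ 0`
    (u : M → ℝ) (φ : ℝ → ℝ → ℝ → ℝ)
    (hu : ContMDiff 𝓘(ℝ, EuclideanSpace ℝ (Fin (2 * m + 1))) 𝓘(ℝ, ℝ) 2 u)
    (hφ_cont : ∀ x₁ x₂, 0 ≤ x₁ → 0 ≤ x₂ → Continuous fun t => φ t x₁ x₂)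
    (hφ_C2 : ∀ t, ContDiffOn ℝ 2 (fun p : ℝ × ℝ => φ t p.1 p.2) (Set.Ici 0))
    (hφ_hess : ∀ t, ∀ p ∈ Set.Ici (0 : ℝ × ℝ), ∀ v : ℝ × ℝ,
      0 ≤ iteratedFDerivWithin ℝ 2 (fun q : ℝ × ℝ => φ t q.1 q.2) (Set.Ici 0) p ![v, v])
    (hu_ineq : ∀ x, φ (u x) (S.vnorm x (S.gradL u x)) (S.vnorm x (S.gradH u x))
      ≤ S.subLaplacian u x)
    -- the comparison function `F`
    (F : ℝ → ℝ) (a : ℝ)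
    (hF_cont : ContinuousOn F (Set.Ici a))
    (hF_pos : ∀ t, a ≤ t → 0 < F t)
    (hF_int : ∃ b, a < b ∧ MeasureTheory.IntegrableOn
      (fun t => (∫ s in a..t, F s) ^ (-(1 / 2) : ℝ)) (Set.Ioi b))
    (hF_growth : limsup (fun t : ℝ => (((∫ s in a..t, F s) / (t * F t) : ℝ) : EReal)) atTop < ⊤)
    (hφ_one : ⊥ < liminf (fun t : ℝ => (((∫ s in a..t, F s) ^ (1 / 2 : ℝ) / F t
      * derivWithin (fun y => φ t y 0) (Set.Ici 0) 0 : ℝ) : EReal)) atTop)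
    (hφ_two : ⊥ < liminf (fun t : ℝ => (((∫ s in a..t, F s) ^ (1 / 2 : ℝ) / F t
      * derivWithin (fun y => φ t 0 y) (Set.Ici 0) 0 : ℝ) : EReal)) atTop) :
    (0 < liminf (fun t : ℝ => ((φ t 0 0 / F t : ℝ) : EReal)) atTop →
      BddAbove (Set.range u) ∧ φ (⨆ x, u x) 0 0 ≤ 0) ∧
    (liminf (fun t : ℝ => ((φ t 0 0 / F t : ℝ) : EReal)) atTop ≤ 0 →
      ¬ BddAbove (Set.range u) ∨ (BddAbove (Set.range u) ∧ φ (⨆ x, u x) 0 0 ≤ 0)) := by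
  have hγ_hyps := fun {g g' g'' : ℝ → ℝ} {β C : ℝ} => S.exists_almost_max (g := g) (g' := g')
    (g'' := g'') (β := β) (C := C) hγ_smooth hA hB hγ_proper hγ_grad hγ_lap hG_smooth hG_zero
    hG_mono hG_int hu
  have hconv : ∀ t, ConvexOn ℝ (Set.Ici (0 : ℝ × ℝ)) fun p : ℝ × ℝ => φ t p.1 p.2 := fun t =>
    .of_iteratedFDerivWithin_two_nonneg (convex_Ici 0) uniqueDiffOn_quadrant (hφ_C2 t)
      (hφ_hess t)
  -- This uses no comparison with `F`. It proves the second assertion outright and reduces the first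
  -- to boundedness of `u`.
  have hsup : BddAbove (Set.range u) → φ (⨆ x, u x) 0 0 ≤ 0 := by
    intro hbdd
    by_contra! hpos
    obtain ⟨h, hh, μ, hμ, hev⟩ := exists_pos_lt_of_pos_corner hφ_cont hconv
      (hφ_C2 _).continuousOn hpos
    obtain ⟨ρ, hρ, hball⟩ := Metric.eventually_nhds_iff.1 hev
    obtain ⟨o, ho⟩ := exists_lt_of_lt_ciSup (sub_lt_self (⨆ x, u x) hρ)
    -- Any `β` below `u o` would do, since `id` is defined everywhere. The tolerance `min h μ` puts
    -- both gradient norms within the range of the lower bound and forces `Δ_b u ≤ μ < φ`.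
    obtain ⟨x, h1, h2, h3, h4⟩ := hγ_hyps (g := id) (g' := fun _ => 1) (g'' := fun _ => 0)
      (β := u o - 1) (C := ⨆ x, u x) (fun t _ => hasDerivAt_id t)
      (fun t _ => hasDerivAt_const t 1) (fun _ _ => one_pos) (fun x _ => le_ciSup hbdd x)
      (sub_one_lt (u o)) (lt_min hh hμ)
    rw [one_mul] at h2 h3
    rw [one_mul, zero_mul, add_zero] at h4
    have h5 : dist (u x) (⨆ x, u x) < ρ := by
      rw [Real.dist_eq, abs_lt]
      have := le_ciSup hbdd x
      constructor <;> linarith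
    have h6 := hball h5 _ _ (S.vnorm_nonneg x (S.gradL u x)) (S.vnorm_nonneg x (S.gradH u x))
      (h3.trans (min_le_left _ _)) (h2.trans (min_le_left _ _))
    linarith [hu_ineq x, min_le_right h μ]
  refine ⟨fun hlim => ?_, fun _ => ?_⟩
  swap
  · by_cases hbdd : BddAbove (Set.range u)
    · exact Or.inr ⟨hbdd, hsup hbdd⟩
    · exact Or.inl hbdd
  suffices hbdd : BddAbove (Set.range u) from ⟨hbdd, hsup hbdd⟩
  by_contra hunb
  obtain ⟨b, hab, hint⟩ := hF_int
  obtain ⟨c, hc, ev1⟩ := exists_pos_eventually_of_pos_liminf hlim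
  obtain ⟨K₁, hK₁, ev2⟩ := eventually_gt_of_bot_lt_liminf hφ_one
  obtain ⟨K₂, hK₂, ev3⟩ := eventually_gt_of_bot_lt_liminf hφ_two
  obtain ⟨C, hC, ev4⟩ := eventually_lt_of_limsup_lt_top hF_growth
  obtain ⟨κ, hκ, ev5⟩ := exists_pos_le_mul_integral_rpow hF_cont hF_pos hab hint hC ev4
  obtain ⟨T, hT⟩ := eventually_atTop.1 (ev1.and (ev2.and (ev3.and (ev5.and
    (eventually_gt_atTop b)))))
  obtain ⟨o, ho⟩ : ∃ o, T < u o := by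
    by_contra! h
    exact hunb ⟨T, by rintro _ ⟨x, rfl⟩; exact h x⟩
  -- The three conditions serve in turn to give `δ² ≤ δ`, to absorb all gradient terms into `c / 2`,
  -- and to contradict `F p ≥ κ`.
  obtain ⟨δ, hδ, hδ1, hδ2, hδ3⟩ : ∃ δ : ℝ, 0 < δ ∧ δ ≤ 1 ∧ δ * (K₁ + K₂ + 1) ≤ c / 2 ∧
      δ < κ * (c / 2) := by
    refine ⟨min (min 1 (c / 2 / (K₁ + K₂ + 1))) (κ * (c / 2) / 2), by positivity,
      (min_le_left _ _).trans (min_le_left _ _), ?_, ?_⟩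
    · rw [← le_div_iff₀ (by positivity)]
      exact (min_le_left _ _).trans (min_le_right _ _)
    · exact (min_le_right _ _).trans_lt (half_lt_self (by positivity))
  -- Although `u` is unbounded, `g(u)` is at most the convergent integral of `p` over `(b, ∞)`, so
  -- the maximum principle applies.
  obtain ⟨x, h1, h2, h3, h4⟩ := hγ_hyps (β := b)
    (fun t ht => hasDerivAt_integral_integral_rpow hF_cont hF_pos hab ht.le)
    (fun t ht => hasDerivAt_integral_rpow hF_cont hF_pos (hab.trans ht))
    (fun t ht => Real.rpow_pos_of_pos (integral_pos_of_gt hF_cont hF_pos (hab.trans ht)) _)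
    (fun x hx => integral_rpow_le hF_cont hF_pos hab hint hx.le) (o := o)
    (hT _ ho.le).2.2.2.2 hδ
  obtain ⟨a1, a2, a3, a4, a5⟩ := hT (u x) (ho.le.trans h1)
  set t := u x
  have hFt := hF_pos t (hab.trans a5).le
  have hP := integral_pos_of_gt hF_cont hF_pos (hab.trans a5)
  have hLe := add_derivWithin_le_of_convexOn (hconv t)
    ((hφ_C2 t).differentiableOn (by simp) 0 (Set.mem_Ici.2 le_rfl))
    (S.vnorm_nonneg x (S.gradL u x)) (S.vnorm_nonneg x (S.gradH u x))
  have hux := hu_ineq x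
  have hl0 := S.vnorm_nonneg x (S.gradL u x)
  have hh0 := S.vnorm_nonneg x (S.gradH u x)
  set l := S.vnorm x (S.gradL u x)
  set k := S.vnorm x (S.gradH u x)
  set d₁ := derivWithin (fun y => φ t y 0) (Set.Ici 0) 0
  set d₂ := derivWithin (fun y => φ t 0 y) (Set.Ici 0) 0
  set p := (∫ s in a..t, F s) ^ (-(1 / 2) : ℝ) with hp
  have hp0 : 0 < p := Real.rpow_pos_of_pos hP _
  have hpr : p * (∫ s in a..t, F s) ^ (1 / 2 : ℝ) = 1 := by
    rw [hp, ← Real.rpow_add hP]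
    norm_num
  -- Multiplying the liminf bound by `F p` cancels `P^{1/2} / F`, where `P = ∫ F`.
  have hd : ∀ K d : ℝ, -K < (∫ s in a..t, F s) ^ (1 / 2 : ℝ) / F t * d → -(K * F t * p) ≤ d := by
    intro K d h
    have e1 := mul_lt_mul_of_pos_left h (mul_pos hFt hp0)
    have e2 : F t * p * ((∫ s in a..t, F s) ^ (1 / 2 : ℝ) / F t * d)
        = (p * (∫ s in a..t, F s) ^ (1 / 2 : ℝ)) * d := by
      field_simp
    rw [e2, hpr] at e1
    linarith
  have e1 := hd K₁ d₁ a2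
  have e2 := hd K₂ d₂ a3
  rw [lt_div_iff₀ hFt] at a1
  have e3 : c * F t - K₁ * F t * p * l - K₂ * F t * p * k ≤ S.subLaplacian u x := by
    nlinarith [mul_le_mul_of_nonneg_right e1 hl0, mul_le_mul_of_nonneg_right e2 hh0]
  have e4 := mul_le_mul_of_nonneg_left e3 hp0.le
  have hFp : 0 < F t * p := by positivity
  have hpk : 0 ≤ p * k := by positivity
  -- This is `p` times the inequality for `u`, combined with the almost-maximum inequality `h4`. In
  -- it the gradients appear only as `p l` and `p k`, which are at most `δ`.
  have e5 : F t * p * (c - K₁ * (p * l) - K₂ * (p * k) - (p * k) ^ 2 / 2) ≤ δ := by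
    linarith
  have e6 : c / 2 ≤ c - K₁ * (p * l) - K₂ * (p * k) - (p * k) ^ 2 / 2 := by
    have f1 := mul_le_mul_of_nonneg_left h3 hK₁.le
    have f2 := mul_le_mul_of_nonneg_left h2 hK₂.le
    have f3 : (p * k) ^ 2 ≤ δ := by nlinarith
    linarith
  have e7 : κ * (c / 2) ≤ F t * p * (c / 2) := by gcongr
  have e8 := mul_le_mul_of_nonneg_left e6 hFp.le
  linarith
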